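/- \textbf{Setting.} Consider the LTI system $\dot x(t)=Ax(t)+Bu(t)$, $y(t)=Cx(t)$ with $x\in\mathbb R^n$, $u\in\mathbb R^m$, $y\in\mathbb R^l$, of relative degree $r\ge 2$, i.e. $CA^iB=0$ for $i=0,\dots,r-2$ and $CA^{r-1}B\ne 0$. For a sampling period $h>0$, sampling instants $t_k=kh$ ($k=0,1,2,\dots$), integers $0<q_1<\dots<q_{r-1}$ and gains $K_0,\dots,K_{r-1}\in\mathbb R^{m\times l}$, the delayed sampled-data controller is $$u(t)=K_0y(t_k)+\sum_{i=1}^{r-1}K_i\,y(t_k-q_ih),\qquad t\in[t_k,t_{k+1}),\ k=0,1,2,\dots,\qquad(1)$$ where $y(t)=0$ for $t<0$. Given $\bar K_0,\dots,\bar K_{r-1}\in\mathbb R^{m\times l}$, the derivative-dependent controller is $$u(t)=\bar K_0y(t)+\bar K_1\dot y(t)+\dots+\bar K_{r-1}y^{(r-1)}(t),\qquad t\ge 0.\qquad(2)$$ A controller exponentially stabilizes the system with decay rate $\alpha$ if the closed loop has a solution on $[0,\infty)$ for every initial state and there is a constant $c$ such that $\|x(t)\|\le c\,e^{-\alpha t}\|x(0)\|$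 for all closed-loop solutions and all $t\ge 0$. Put $q_0=0$ and $$M=\Bigl[\tfrac{(-q_ih)^j}{j!}I_l\Bigr]_{i,j=0}^{r-1}\quad(\text{with }0^0=1),\qquad \bar C=\begin{bmatrix}C\\CA\\ \vdots\\ CA^{r-1}\end{bmatrix},\qquad D=A+B[K_0,K_1,\dots,K_{r-1}]M\bar C.$$ \textbf{Theorem.} (i) Let $h>0$, integers $0<q_1<\dots<q_{r-1}$, gains $K_0,\dots,K_{r-1}\in\mathbb R^{m\times l}$ and $\alpha>0$ be given. Suppose there are (symmetric) positive-definite matrices $P\in\mathbb R^{n\times n}$ and $W_0,\dots,W_{r-1},R_1,\dots,R_{r-1}\in\mathbb R^{m\times m}$ such that $\Phi\le 0$, where $\Phi=\{\Phi_{ij}\}_{i,j=1}^4$ is the symmetric block matrix with $$\Phi_{11}=PD+D^TP+2\alpha P+h^2e^{2\alpha h}\sum_{i=0}^{r-1}(K_iCA)^TW_i(K_iCA),$$ $$\Phi_{12}=\mathbf 1_r^T\otimes PB,\quad \Phi_{13}=\mathbf 1_{r-1}^T\otimes PB,\quad \Phi_{14}=(CA^{r-1}D)^TH,\quad \Phi_{23}=0,$$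 $$\Phi_{24}=\mathbf 1_r\otimes(CA^{r-1}B)^TH,\quad \Phi_{34}=\mathbf 1_{r-1}\otimes(CA^{r-1}B)^TH,\quad \Phi_{44}=-H,$$ $$\Phi_{22}=-\tfrac{\pi^2}{4}\operatorname{diag}\{W_0,e^{-2\alpha q_1h}W_1,\dots,e^{-2\alpha q_{r-1}h}W_{r-1}\},$$ $$\Phi_{33}=-(r!)^2\operatorname{diag}\Bigl\{\tfrac{e^{-2\alpha q_1h}}{(q_1h)^r}R_1,\dots,\tfrac{e^{-2\alpha q_{r-1}h}}{(q_{r-1}h)^r}R_{r-1}\Bigr\},\qquad H=\sum_{i=1}^{r-1}(q_ih)^rK_i^TR_iK_i,$$ and $\mathbf 1_s\in\mathbb R^s$ is the vector of ones. Then controller (1) exponentially stabilizes the system with decay rate $\alpha$. (ii) Suppose that, for some $\bar K_0,\dots,\bar K_{r-1}\in\mathbb R^{m\times l}$, controller (2) exponentially stabilizes the system with a decay rate $\alpha'>0$. Then for every $\alpha<\alpha'$ there is $h_0>0$ such that for every $h\in(0,h_0)$, with $q_i=i\lfloor h^{\frac1r-1}\rfloor$ ($i=1,\dots,r-1$), one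 has $0<q_1<\dots<q_{r-1}$, the matrix $M$ is invertible, and controller (1) with gains $[K_0,\dots,K_{r-1}]=[\bar K_0,\dots,\bar K_{r-1}]M^{-1}$ exponentially stabilizes the system with decay rate $\alpha$. -/

import Mathlib

open scoped Nat Matrix

noncomputable section

namespace SampledData

/-- The system `x' = A x + B u`, `y = C x` has relative degree `r`:
`C A^i B = 0` for `i = 0, …, r - 2` and `C A^(r-1) B ≠ 0`. -/
def HasRelativeDegree {n m l : ℕ} (A : Matrix (Fin n) (Fin n) ℝ) (B : Matrix (Fin n) (Fin m) ℝ)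
    (C : Matrix (Fin l) (Fin n) ℝ) (r : ℕ) : Prop :=
  (∀ i : ℕ, i + 2 ≤ r → C * A ^ i * B = 0) ∧ C * A ^ (r - 1) * B ≠ 0

/-- `x` is a state trajectory on `[0, ∞)` of `x' = A x + B u`: it is continuous and satisfies the
equation with the right derivative (the inputs considered here are right continuous, with jumps
at most at the sampling instants). -/
def IsTrajectory {n m : ℕ} (A : Matrix (Fin n) (Fin n) ℝ) (B : Matrix (Fin n) (Fin m) ℝ)
    (u : ℝ → Fin m → ℝ) (x : ℝ → Fin n → ℝ) : Prop :=
  ContinuousOn x (Set.Ici 0) ∧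
    ∀ t : ℝ, 0 ≤ t → HasDerivWithinAt x (A *ᵥ x t + B *ᵥ u t) (Set.Ici t) t

/-- The output: `y(t) = C x(t)` for `t ≥ 0`, and `y(t) = 0` for `t < 0`. -/
def output {n l : ℕ} (C : Matrix (Fin l) (Fin n) ℝ) (x : ℝ → Fin n → ℝ) (t : ℝ) : Fin l → ℝ :=
  if 0 ≤ t then C *ᵥ x t else 0

/-- `x` is a closed-loop trajectory under the derivative-dependent controller
`u(t) = K₀ y(t) + K₁ y'(t) + ⋯ + K_{r-1} y^{(r-1)}(t)`, `t ≥ 0`. Only the values of the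
family `Kbar` at indices `< r` are used. -/
def IsDerivativeLoop {n m l : ℕ} (A : Matrix (Fin n) (Fin n) ℝ) (B : Matrix (Fin n) (Fin m) ℝ)
    (C : Matrix (Fin l) (Fin n) ℝ) (r : ℕ) (Kbar : ℕ → Matrix (Fin m) (Fin l) ℝ)
    (x : ℝ → Fin n → ℝ) : Prop :=
  ∃ u : ℝ → Fin m → ℝ, IsTrajectory A B u x ∧
    ∀ t : ℝ, 0 ≤ t →
      u t = ∑ i ∈ Finset.range r,
        Kbar i *ᵥ iteratedDerivWithin i (output C x) (Set.Ici 0) t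

/-- `x` is a closed-loop trajectory under the delayed sampled-data controller
`u(t) = K₀ y(t_k) + ∑_{i=1}^{r-1} K_i y(t_k - q_i h)`, `t ∈ [t_k, t_{k+1})`, `t_k = k h`.
The term with `K₀` is the one with `i = 0`, under the convention `q 0 = 0`. -/
def IsSampledLoop {n m l : ℕ} (A : Matrix (Fin n) (Fin n) ℝ) (B : Matrix (Fin n) (Fin m) ℝ)
    (C : Matrix (Fin l) (Fin n) ℝ) (r : ℕ) (h : ℝ) (q : ℕ → ℕ)
    (K : ℕ → Matrix (Fin m) (Fin l) ℝ) (x : ℝ → Fin n → ℝ) : Prop :=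
  ∃ u : ℝ → Fin m → ℝ, IsTrajectory A B u x ∧
    ∀ k : ℕ, ∀ t ∈ Set.Ico ((k : ℝ) * h) (((k : ℝ) + 1) * h),
      u t = ∑ i ∈ Finset.range r, K i *ᵥ output C x ((k : ℝ) * h - (q i : ℝ) * h)

/-- A closed loop, given by its set of trajectories, is exponentially stable with decay rate `α`:
every initial state starts a trajectory, and there is a constant `c` such that
`‖x(t)‖ ≤ c e^{-α t} ‖x(0)‖` (Euclidean norm) for all trajectories and all `t ≥ 0`. -/
def IsExpStable {n : ℕ} (Loop : (ℝ → Fin n → ℝ) → Prop) (α : ℝ) : Prop :=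
  (∀ x₀ : Fin n → ℝ, ∃ x, Loop x ∧ x 0 = x₀) ∧
    ∃ c : ℝ, ∀ x, Loop x → ∀ t : ℝ, 0 ≤ t →
      ‖WithLp.toLp 2 (x t)‖ ≤ c * Real.exp (-α * t) * ‖WithLp.toLp 2 (x 0)‖

/-! Block matrices. The index `(a, i)` is coordinate `a` of block `i`. -/

/-- The block row `[K₀, K₁, …, K_{r-1}]`. -/
def gainRow {m l : ℕ} (r : ℕ) (K : ℕ → Matrix (Fin m) (Fin l) ℝ) :
    Matrix (Fin m) (Fin l × Fin r) ℝ :=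
  Matrix.of fun a p => K p.2 a p.1

/-- The Vandermonde-type matrix `M`, with blocks `((-q_i h)^j / j!) I_l`, `i, j = 0, …, r - 1`.
As `q 0 = 0`, its first block row is `[I_l, 0, …, 0]`. -/
def vandermondeM (l r : ℕ) (h : ℝ) (q : ℕ → ℕ) : Matrix (Fin l × Fin r) (Fin l × Fin r) ℝ :=
  Matrix.of fun p s =>
    ((-((q p.2 : ℝ) * h)) ^ (s.2 : ℕ) / ((s.2 : ℕ)! : ℝ)) * (1 : Matrix (Fin l) (Fin l) ℝ) p.1 s.1

/-- The block column `col {C, C A, …, C A^(r-1)}`. -/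
def outputCol {n l : ℕ} (A : Matrix (Fin n) (Fin n) ℝ) (C : Matrix (Fin l) (Fin n) ℝ) (r : ℕ) :
    Matrix (Fin l × Fin r) (Fin n) ℝ :=
  Matrix.of fun p b => (C * A ^ (p.2 : ℕ)) p.1 b

/-- `D = A + B [K₀, …, K_{r-1}] M col {C, C A, …, C A^(r-1)}`. -/
def matD {n m l : ℕ} (A : Matrix (Fin n) (Fin n) ℝ) (B : Matrix (Fin n) (Fin m) ℝ)
    (C : Matrix (Fin l) (Fin n) ℝ) (r : ℕ) (h : ℝ) (q : ℕ → ℕ)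
    (K : ℕ → Matrix (Fin m) (Fin l) ℝ) : Matrix (Fin n) (Fin n) ℝ :=
  A + B * (gainRow r K * vandermondeM l r h q * outputCol A C r)

/-- `H = ∑_{i=1}^{r-1} (q_i h)^r K_iᵀ R_i K_i`. -/
def matH {m l : ℕ} (r : ℕ) (h : ℝ) (q : ℕ → ℕ) (K : ℕ → Matrix (Fin m) (Fin l) ℝ)
    (R : ℕ → Matrix (Fin m) (Fin m) ℝ) : Matrix (Fin l) (Fin l) ℝ :=
  ∑ i ∈ Finset.Icc 1 (r - 1), ((q i : ℝ) * h) ^ r • ((K i)ᵀ * R i * K i)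

/-- `1_sᵀ ⊗ X = [X, …, X]` (`s` blocks). -/
def repeatRow {a b : ℕ} (s : ℕ) (X : Matrix (Fin a) (Fin b) ℝ) :
    Matrix (Fin a) (Fin b × Fin s) ℝ :=
  X.submatrix id Prod.fst

/-- `1_s ⊗ X = col {X, …, X}` (`s` blocks). -/
def repeatCol {a b : ℕ} (s : ℕ) (X : Matrix (Fin a) (Fin b) ℝ) :
    Matrix (Fin a × Fin s) (Fin b) ℝ :=
  X.submatrix Prod.fst id

/-- `Φ₁₁ = P D + Dᵀ P + 2 α P + h² e^{2 α h} ∑_{i=0}^{r-1} (K_i C A)ᵀ W_i (K_i C A)`. -/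
def Phi11 {n m l : ℕ} (A : Matrix (Fin n) (Fin n) ℝ) (B : Matrix (Fin n) (Fin m) ℝ)
    (C : Matrix (Fin l) (Fin n) ℝ) (r : ℕ) (h : ℝ) (q : ℕ → ℕ)
    (K : ℕ → Matrix (Fin m) (Fin l) ℝ) (α : ℝ) (P : Matrix (Fin n) (Fin n) ℝ)
    (W : ℕ → Matrix (Fin m) (Fin m) ℝ) : Matrix (Fin n) (Fin n) ℝ :=
  P * matD A B C r h q K + (matD A B C r h q K)ᵀ * P + (2 * α) • P +
    (h ^ 2 * Real.exp (2 * α * h)) •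
      ∑ i ∈ Finset.range r, (K i * C * A)ᵀ * W i * (K i * C * A)

/-- `Φ₂₂ = -(π²/4) diag {W₀, e^{-2 α q₁ h} W₁, …, e^{-2 α q_{r-1} h} W_{r-1}}` (with `q 0 = 0`). -/
def Phi22 {m : ℕ} (r : ℕ) (h : ℝ) (q : ℕ → ℕ) (α : ℝ) (W : ℕ → Matrix (Fin m) (Fin m) ℝ) :
    Matrix (Fin m × Fin r) (Fin m × Fin r) ℝ :=
  (-(Real.pi ^ 2 / 4)) • Matrix.blockDiagonal
    fun i : Fin r => Real.exp (-2 * α * ((q i : ℝ) * h)) • W i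

/-- `Φ₃₃ = -(r!)² diag {e^{-2 α q_i h} (q_i h)^{-r} R_i}`, `i = 1, …, r - 1`. -/
def Phi33 {m : ℕ} (r : ℕ) (h : ℝ) (q : ℕ → ℕ) (α : ℝ) (R : ℕ → Matrix (Fin m) (Fin m) ℝ) :
    Matrix (Fin m × Fin (r - 1)) (Fin m × Fin (r - 1)) ℝ :=
  (-((r ! : ℝ) ^ 2)) • Matrix.blockDiagonal
    fun i : Fin (r - 1) =>
      (Real.exp (-2 * α * ((q (i + 1) : ℝ) * h)) / ((q (i + 1) : ℝ) * h) ^ r) • R (i + 1)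

/-- The symmetric 4 × 4 block matrix `Φ`; the block `Φ₂₃` is zero. -/
def Phi {n m l : ℕ} (A : Matrix (Fin n) (Fin n) ℝ) (B : Matrix (Fin n) (Fin m) ℝ)
    (C : Matrix (Fin l) (Fin n) ℝ) (r : ℕ) (h : ℝ) (q : ℕ → ℕ)
    (K : ℕ → Matrix (Fin m) (Fin l) ℝ) (α : ℝ) (P : Matrix (Fin n) (Fin n) ℝ)
    (W R : ℕ → Matrix (Fin m) (Fin m) ℝ) :
    Matrix ((Fin n ⊕ (Fin m × Fin r)) ⊕ ((Fin m × Fin (r - 1)) ⊕ Fin l))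
      ((Fin n ⊕ (Fin m × Fin r)) ⊕ ((Fin m × Fin (r - 1)) ⊕ Fin l)) ℝ :=
  let D := matD A B C r h q K
  let H := matH r h q K R
  let Phi12 := repeatRow r (P * B)
  let Phi13 := repeatRow (r - 1) (P * B)
  let Phi14 := (C * A ^ (r - 1) * D)ᵀ * H
  let Phi24 := repeatCol r ((C * A ^ (r - 1) * B)ᵀ * H)
  let Phi34 := repeatCol (r - 1) ((C * A ^ (r - 1) * B)ᵀ * H)
  let upperRight := Matrix.fromBlocks Phi13 Phi14 0 Phi24
  Matrix.fromBlocks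
    (Matrix.fromBlocks (Phi11 A B C r h q K α P W) Phi12 Phi12ᵀ (Phi22 r h q α W))
    upperRight
    upperRightᵀ
    (Matrix.fromBlocks (Phi33 r h q α R) Phi34 Phi34ᵀ (-H))

end SampledData

end

/-!
Replacing `y(t_k - q_i h)` by `y(t - q_i h)`, and this by the Taylor polynomial of degree `r - 1` of
`y` at `t`, turns the sampled-data loop into `x' = D x` plus `B` times two kinds of errors: sampling
errors `K_i (y(t_k - q_i h) - y(t - q_i h))` and Taylor remainders of delayed outputs. Since
`C A^i B = 0` for `i < r - 1`, the derivatives of `y` up to order `r - 1` are linear in `x`, so that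
the jumps of the input only enter `y^{(r)}`.

For (i), Wirtinger's inequality bounds the exponentially weighted `L²` norm of a sampling error by
that of `y'`, and Cauchy–Schwarz for the integral form of the remainder bounds that of a Taylor
remainder by that of `y^{(r)}`. The condition `Φ ≤ 0` says precisely that `xᵀ P x` decays at rate
`2 α` up to the difference of the two sides of these inequalities, whose integrals have a sign.

For (ii), take for `P` a finite-horizon Gramian of the derivative-dependent loop, whose system
matrix is `D` because the factor `M⁻¹` in the gains cancels `M`. With `η` the smallest delay
`q_1 h ≈ h^{1/r}`, the gains are `O(η^{1-r})` while the sampling period is `O(η^r)`. Scalar weights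
`W_i = η⁻¹` and `R_i = η^{r-1}` then make all cross terms in the dissipation inequality vanish as
`η → 0`.
-/

noncomputable section

namespace SampledData

open Set MeasureTheory Filter Topology intervalIntegral

variable {E : Type*} [NormedAddCommGroup E] [InnerProductSpace ℝ E]
  {F : Type*} [NormedAddCommGroup F]

section Integrals

/-- Strongly measurable functions of time that are bounded on bounded time intervals: the class of
integrands of this development, closed under sampling, delays and continuous bilinear products. -/
def IsLocBdd (g : ℝ → F) : Prop :=
  StronglyMeasurable g ∧ ∀ b : ℝ, ∃ c : ℝ, ∀ t, |t| ≤ b → ‖g t‖ ≤ c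

namespace IsLocBdd

theorem of_continuous {g : ℝ → F} (hg : Continuous g) : IsLocBdd g := by
  refine ⟨hg.stronglyMeasurable, fun b => ?_⟩
  obtain ⟨c, hc⟩ := (isCompact_Icc (a := -b) (b := b)).exists_bound_of_continuousOn
    hg.continuousOn
  exact ⟨c, fun t ht => hc t (abs_le.mp ht)⟩

theorem add {f g : ℝ → F} (hf : IsLocBdd f) (hg : IsLocBdd g) :
    IsLocBdd (fun t => f t + g t) := by
  refine ⟨hf.1.add hg.1, fun b => ?_⟩
  obtain ⟨c, hc⟩ := hf.2 b
  obtain ⟨d, hd⟩ := hg.2 b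
  exact ⟨c + d, fun t ht => norm_add_le_of_le (hc t ht) (hd t ht)⟩

theorem sub {f g : ℝ → F} (hf : IsLocBdd f) (hg : IsLocBdd g) :
    IsLocBdd (fun t => f t - g t) := by
  refine ⟨hf.1.sub hg.1, fun b => ?_⟩
  obtain ⟨c, hc⟩ := hf.2 b
  obtain ⟨d, hd⟩ := hg.2 b
  exact ⟨c + d, fun t ht => (norm_sub_le _ _).trans (add_le_add (hc t ht) (hd t ht))⟩

theorem smul [NormedSpace ℝ F] {f : ℝ → ℝ} {g : ℝ → F} (hf : IsLocBdd f) (hg : IsLocBdd g) :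
    IsLocBdd (fun t => f t • g t) := by
  refine ⟨hf.1.smul hg.1, fun b => ?_⟩
  obtain ⟨c, hc⟩ := hf.2 b
  obtain ⟨d, hd⟩ := hg.2 b
  refine ⟨c * d, fun t ht => ?_⟩
  rw [norm_smul]
  exact mul_le_mul (hc t ht) (hd t ht) (norm_nonneg _) ((norm_nonneg _).trans (hc t ht))

theorem mul {f g : ℝ → ℝ} (hf : IsLocBdd f) (hg : IsLocBdd g) :
    IsLocBdd (fun t => f t * g t) :=
  hf.smul hg

theorem continuous_mul {f g : ℝ → ℝ} (hf : Continuous f) (hg : IsLocBdd g) :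
    IsLocBdd (fun t => f t * g t) :=
  (of_continuous hf).mul hg

theorem norm_sq {g : ℝ → F} (hg : IsLocBdd g) : IsLocBdd (fun t => ‖g t‖ ^ 2) := by
  have hnorm : IsLocBdd (fun t => ‖g t‖) := ⟨hg.1.norm, by simpa only [norm_norm] using hg.2⟩
  simpa only [pow_two] using hnorm.mul hnorm

theorem sum {ι : Type*} (s : Finset ι) {f : ι → ℝ → F} (hf : ∀ i ∈ s, IsLocBdd (f i)) :
    IsLocBdd (fun t => ∑ i ∈ s, f i t) := by
  refine ⟨Finset.stronglyMeasurable_fun_sum s fun i hi => (hf i hi).1, fun b => ?_⟩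
  choose! c hc using fun i (hi : i ∈ s) => (hf i hi).2 b
  exact ⟨∑ i ∈ s, c i, fun t ht => norm_sum_le_of_le s fun i hi => hc i hi t ht⟩

theorem comp_sub {g : ℝ → F} (hg : IsLocBdd g) (c : ℝ) : IsLocBdd (fun t => g (t - c)) := by
  refine ⟨hg.1.comp_measurable (measurable_id.sub_const c), fun b => ?_⟩
  obtain ⟨d, hd⟩ := hg.2 (b + |c|)
  exact ⟨d, fun t ht => hd _ ((abs_sub _ _).trans (by linarith))⟩

theorem intervalIntegrable {g : ℝ → F} (hg : IsLocBdd g) (a b : ℝ) :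
    IntervalIntegrable g volume a b := by
  obtain ⟨c, hc⟩ := hg.2 (max |a| |b|)
  refine (intervalIntegrable_const (c := c)).mono_fun hg.1.aestronglyMeasurable ?_
  filter_upwards [ae_restrict_mem measurableSet_uIoc] with t ht
  refine (hc t ?_).trans (le_abs_self c)
  rcases mem_uIcc.1 (uIoc_subset_uIcc ht) with ⟨h1, h2⟩ | ⟨h1, h2⟩
  · exact abs_le_max_abs_abs h1 h2
  · exact max_comm |a| |b| ▸ abs_le_max_abs_abs h1 h2

end IsLocBdd

end Integrals

section Sampling

/-- The last sampling instant `⌊t / h⌋ h` before time `t ≥ 0`. -/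
def sampleTime (h t : ℝ) : ℝ := ⌊t / h⌋₊ * h

variable {h : ℝ}

theorem floor_div_eq (hh : 0 < h) {k : ℕ} {t : ℝ} (hkt : k * h ≤ t) (htk : t < (k + 1) * h) :
    ⌊t / h⌋₊ = k := by
  have ht : 0 ≤ t / h := div_nonneg (le_trans (by positivity) hkt) hh.le
  exact (Nat.floor_eq_iff ht).2 ⟨(le_div_iff₀ hh).2 hkt, (div_lt_iff₀ hh).2 htk⟩

theorem sampleTime_eq (hh : 0 < h) {k : ℕ} {t : ℝ} (hkt : k * h ≤ t) (htk : t < (k + 1) * h) :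
    sampleTime h t = k * h := by
  rw [sampleTime, floor_div_eq hh hkt htk]

theorem sampleTime_le (hh : 0 < h) {t : ℝ} (ht : 0 ≤ t) : sampleTime h t ≤ t :=
  (le_div_iff₀ hh).1 (Nat.floor_le (div_nonneg ht hh.le))

theorem le_sampleTime_add (hh : 0 < h) (t : ℝ) : t ≤ sampleTime h t + h := by
  have := ((div_lt_iff₀ hh).1 (Nat.lt_floor_add_one (t / h))).le
  rwa [add_one_mul] at this

theorem le_sampleTime (hh : 0 < h) {k : ℕ} {t : ℝ} (hkt : k * h ≤ t) : k * h ≤ sampleTime h t := by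
  have : k ≤ ⌊t / h⌋₊ := Nat.le_floor ((le_div_iff₀ hh).2 hkt)
  unfold sampleTime
  gcongr

theorem sampleTime_sub (hh : 0 < h) {q : ℕ} {t : ℝ} (hqt : q * h ≤ t) :
    sampleTime h (t - q * h) = sampleTime h t - q * h := by
  have hfloor : q ≤ ⌊t / h⌋₊ := Nat.le_floor ((le_div_iff₀ hh).2 hqt)
  rw [sampleTime, sampleTime, sub_div, mul_div_cancel_right₀ _ hh.ne', Nat.floor_sub_natCast,
    Nat.cast_sub hfloor, sub_mul]

theorem IsLocBdd.comp_floor (hh : 0 < h) (w : ℕ → F) : IsLocBdd (fun t => w ⌊t / h⌋₊) := by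
  refine ⟨(StronglyMeasurable.of_discrete (f := w)).comp_measurable
    (Nat.measurable_floor.comp (measurable_id.div_const h)), fun b => ?_⟩
  refine ⟨∑ k ∈ Finset.range (⌊b / h⌋₊ + 1), ‖w k‖, fun t ht => ?_⟩
  refine Finset.single_le_sum (f := fun k => ‖w k‖) (fun _ _ => norm_nonneg _) ?_
  rw [Finset.mem_range, Nat.lt_succ_iff]
  exact Nat.floor_le_floor (div_le_div_of_nonneg_right ((le_abs_self t).trans ht) hh.le)

theorem IsLocBdd.comp_sampleTime (hh : 0 < h) (w : ℝ → F) :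
    IsLocBdd (fun t => w (sampleTime h t)) :=
  .comp_floor hh fun k => w (k * h)

theorem integral_nonneg_of_sampling_intervals {p : ℝ → ℝ} (hp : IsLocBdd p) (hh : 0 < h)
    (hloc : ∀ (k : ℕ) (t : ℝ), k * h ≤ t → t ≤ k * h + h → 0 ≤ ∫ s in (k * h)..t, p s)
    (N : ℕ) {t : ℝ} (ht : N * h ≤ t) : 0 ≤ ∫ s in (N * h)..t, p s := by
  have grid : ∀ k : ℕ, N ≤ k → 0 ≤ ∫ s in (N * h)..(k * h), p s := by
    intro k hk
    induction k, hk using Nat.le_induction with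
    | base => simp
    | succ k _ ih =>
      rw [← integral_add_adjacent_intervals (hp.intervalIntegrable _ (k * h))
        (hp.intervalIntegrable _ _)]
      exact add_nonneg ih (hloc k _ (by push_cast; linarith) (by push_cast; linarith))
  rw [← integral_add_adjacent_intervals (hp.intervalIntegrable _ (sampleTime h t))
    (hp.intervalIntegrable _ _)]
  exact add_nonneg (grid _ (Nat.le_floor ((le_div_iff₀ hh).2 ht)))
    (hloc _ t (sampleTime_le hh (le_trans (by positivity) ht)) (le_sampleTime_add hh t))

end Sampling

section Wirtinger

variable {f g : ℝ → E} {a b h α : ℝ}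

theorem wirtinger_of_lt {c : ℝ} (hab : a ≤ b) (hc : 0 < c) (hcb : c * (b - a) < Real.pi / 2)
    (hf : ContinuousOn f (Icc a b)) (hg : ContinuousOn g (Icc a b))
    (hd : ∀ t ∈ Ioo a b, HasDerivWithinAt f (g t) (Ioi t) t) :
    c ^ 2 * ∫ t in a..b, ‖f t - f a‖ ^ 2 ≤ ∫ t in a..b, ‖g t‖ ^ 2 := by
  have hcos : ∀ t ∈ Icc a b, Real.cos (c * (b - t)) ≠ 0 := fun t ht => by
    refine (Real.cos_pos_of_mem_Ioo ⟨?_, hcb.trans_le' ?_⟩).ne'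
    · linarith [Real.pi_pos, mul_nonneg hc.le (sub_nonneg.2 ht.2)]
    · exact mul_le_mul_of_nonneg_left (sub_le_sub_left ht.1 b) hc.le
  have hfsq : ContinuousOn (fun t => ‖f t - f a‖ ^ 2) (Icc a b) :=
    (hf.sub continuousOn_const).norm.pow 2
  have hgsq : ContinuousOn (fun t => ‖g t‖ ^ 2) (Icc a b) := hg.norm.pow 2
  have hint : IntegrableOn (fun t => ‖g t‖ ^ 2 - c ^ 2 * ‖f t - f a‖ ^ 2) (Icc a b) :=
    (hgsq.sub (continuousOn_const.mul hfsq)).integrableOn_Icc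
  -- The auxiliary function `c tan (c (b - t)) ‖f t - f a‖²` vanishes at both endpoints.
  have key := sub_le_integral_of_hasDeriv_right_of_le hab
    (g := fun t => c * Real.tan (c * (b - t)) * ‖f t - f a‖ ^ 2)
    (g' := fun t => c * ((1 + Real.tan (c * (b - t)) ^ 2) * (-c)) * ‖f t - f a‖ ^ 2 +
      c * Real.tan (c * (b - t)) * (2 * inner ℝ (f t - f a) (g t)))
    ((continuousOn_const.mul (Real.continuousOn_tan.comp (by fun_prop) hcos)).mul hfsq)
    (fun t ht => ?_) hint fun t _ => ?_
  · rw [integral_sub (hgsq.intervalIntegrable_of_Icc hab)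
      ((hfsq.intervalIntegrable_of_Icc hab).const_mul _),
      intervalIntegral.integral_const_mul] at key
    simpa using key
  · have hlin : HasDerivAt (fun t => c * (b - t)) (-c) t := by
      simpa using ((hasDerivAt_id t).const_sub b).const_mul c
    have htan : HasDerivAt (fun t => Real.tan (c * (b - t)))
        ((1 + Real.tan (c * (b - t)) ^ 2) * (-c)) t := by
      have hcost := hcos t (Ioo_subset_Icc_self ht)
      refine ((Real.hasDerivAt_tan hcost).comp t hlin).congr_deriv ?_
      rw [one_div, ← Real.inv_one_add_tan_sq hcost, inv_inv]
    exact (htan.const_mul c).hasDerivWithinAt.mul ((hd t ht).sub_const (f a)).norm_sq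
  · have hsq := sq_nonneg ‖g t - (c * Real.tan (c * (b - t))) • (f t - f a)‖
    rw [norm_sub_sq_real, inner_smul_right, norm_smul, mul_pow, Real.norm_eq_abs, sq_abs,
      real_inner_comm] at hsq
    linear_combination hsq

theorem wirtinger (hab : a ≤ b) (hh : 0 < h) (hbh : b - a ≤ h)
    (hf : ContinuousOn f (Icc a b)) (hg : ContinuousOn g (Icc a b))
    (hd : ∀ t ∈ Ioo a b, HasDerivWithinAt f (g t) (Ioi t) t) :
    Real.pi ^ 2 / 4 * ∫ t in a..b, ‖f t - f a‖ ^ 2 ≤ h ^ 2 * ∫ t in a..b, ‖g t‖ ^ 2 := by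
  set I := ∫ t in a..b, ‖f t - f a‖ ^ 2
  set J := ∫ t in a..b, ‖g t‖ ^ 2
  have hlim : Tendsto (fun c : ℝ => c ^ 2 * I) (𝓝[<] (Real.pi / (2 * h)))
      (𝓝 ((Real.pi / (2 * h)) ^ 2 * I)) :=
    (Continuous.tendsto (by fun_prop) _).mono_left nhdsWithin_le_nhds
  have hcrit : (Real.pi / (2 * h)) ^ 2 * I ≤ J := by
    refine le_of_tendsto hlim ?_
    filter_upwards [Ioo_mem_nhdsLT (show 0 < Real.pi / (2 * h) by positivity)] with c ⟨hc, hcπ⟩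
    rw [lt_div_iff₀ (by positivity)] at hcπ
    exact wirtinger_of_lt hab hc
      ((mul_le_mul_of_nonneg_left hbh hc.le).trans_lt (by linarith)) hf hg hd
  calc Real.pi ^ 2 / 4 * I = h ^ 2 * ((Real.pi / (2 * h)) ^ 2 * I) := by field_simp; ring
    _ ≤ h ^ 2 * J := by gcongr

theorem wirtinger_exp (hab : a ≤ b) (hh : 0 < h) (hbh : b - a ≤ h) (hα : 0 ≤ α)
    (hf : ContinuousOn f (Icc a b)) (hg : ContinuousOn g (Icc a b))
    (hd : ∀ t ∈ Ioo a b, HasDerivWithinAt f (g t) (Ioi t) t) :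
    Real.pi ^ 2 / 4 * ∫ t in a..b, Real.exp (2 * α * t) * ‖f t - f a‖ ^ 2 ≤
      h ^ 2 * Real.exp (2 * α * h) * ∫ t in a..b, Real.exp (2 * α * t) * ‖g t‖ ^ 2 := by
  have hexp : ContinuousOn (fun t => Real.exp (2 * α * t)) (Icc a b) := by fun_prop
  have hfsq : ContinuousOn (fun t => ‖f t - f a‖ ^ 2) (Icc a b) :=
    (hf.sub continuousOn_const).norm.pow 2
  have hgsq : ContinuousOn (fun t => ‖g t‖ ^ 2) (Icc a b) := hg.norm.pow 2
  have hleft : ∫ t in a..b, Real.exp (2 * α * t) * ‖f t - f a‖ ^ 2 ≤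
      Real.exp (2 * α * b) * ∫ t in a..b, ‖f t - f a‖ ^ 2 := by
    rw [← intervalIntegral.integral_const_mul]
    refine integral_mono_on hab ((hexp.mul hfsq).intervalIntegrable_of_Icc hab)
      ((continuousOn_const.mul hfsq).intervalIntegrable_of_Icc hab) fun t ht => ?_
    gcongr
    exact ht.2
  have hright : Real.exp (2 * α * a) * ∫ t in a..b, ‖g t‖ ^ 2 ≤
      ∫ t in a..b, Real.exp (2 * α * t) * ‖g t‖ ^ 2 := by
    rw [← intervalIntegral.integral_const_mul]
    refine integral_mono_on hab ((continuousOn_const.mul hgsq).intervalIntegrable_of_Icc hab)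
      ((hexp.mul hgsq).intervalIntegrable_of_Icc hab) fun t ht => ?_
    gcongr
    exact ht.1
  have hexp_le : Real.exp (2 * α * b) ≤ Real.exp (2 * α * h) * Real.exp (2 * α * a) := by
    rw [← Real.exp_add, ← mul_add]
    gcongr
    linarith
  have : 0 ≤ ∫ t in a..b, ‖g t‖ ^ 2 := integral_nonneg hab fun t _ => sq_nonneg _
  calc _ ≤ Real.pi ^ 2 / 4 * (Real.exp (2 * α * b) * ∫ t in a..b, ‖f t - f a‖ ^ 2) := by gcongr
    _ = Real.exp (2 * α * b) * (Real.pi ^ 2 / 4 * ∫ t in a..b, ‖f t - f a‖ ^ 2) := by ring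
    _ ≤ Real.exp (2 * α * b) * (h ^ 2 * ∫ t in a..b, ‖g t‖ ^ 2) := by
      gcongr ?_ * ?_
      exact wirtinger hab hh hbh hf hg hd
    _ ≤ Real.exp (2 * α * h) * Real.exp (2 * α * a) * (h ^ 2 * ∫ t in a..b, ‖g t‖ ^ 2) := by gcongr
    _ = h ^ 2 * Real.exp (2 * α * h) * (Real.exp (2 * α * a) * ∫ t in a..b, ‖g t‖ ^ 2) := by ring
    _ ≤ _ := by gcongr

theorem wirtinger_sampleTime (hh : 0 < h) (hα : 0 ≤ α) (hf : Continuous f) (hg : Continuous g)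
    (hd : ∀ t, 0 ≤ t → HasDerivWithinAt f (g t) (Ici t) t) (N : ℕ) {t : ℝ} (ht : N * h ≤ t) :
    Real.pi ^ 2 / 4 * ∫ s in (N * h)..t, Real.exp (2 * α * s) * ‖f s - f (sampleTime h s)‖ ^ 2 ≤
      h ^ 2 * Real.exp (2 * α * h) * ∫ s in (N * h)..t, Real.exp (2 * α * s) * ‖g s‖ ^ 2 := by
  have herr : IsLocBdd (fun s => Real.pi ^ 2 / 4 *
      (Real.exp (2 * α * s) * ‖f s - f (sampleTime h s)‖ ^ 2)) :=
    .continuous_mul continuous_const (.continuous_mul (by fun_prop)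
      ((IsLocBdd.of_continuous hf).sub (.comp_sampleTime hh f)).norm_sq)
  have hrate : IsLocBdd (fun s => h ^ 2 * Real.exp (2 * α * h) *
      (Real.exp (2 * α * s) * ‖g s‖ ^ 2)) := .of_continuous (by fun_prop)
  rw [← sub_nonneg, ← intervalIntegral.integral_const_mul, ← intervalIntegral.integral_const_mul,
    ← integral_sub (hrate.intervalIntegrable _ _) (herr.intervalIntegrable _ _)]
  refine integral_nonneg_of_sampling_intervals (hrate.sub herr) hh (fun k t hkt htk => ?_) N ht
  rw [integral_sub (hrate.intervalIntegrable _ _) (herr.intervalIntegrable _ _),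
    intervalIntegral.integral_const_mul, intervalIntegral.integral_const_mul, sub_nonneg]
  have hcell : ∫ s in (k * h)..t, Real.exp (2 * α * s) * ‖f s - f (sampleTime h s)‖ ^ 2 =
      ∫ s in (k * h)..t, Real.exp (2 * α * s) * ‖f s - f (k * h)‖ ^ 2 :=
    integral_congr_Ioo_of_le hkt fun s hs => by
      simp only [sampleTime_eq hh hs.1.le (by linarith [hs.2])]
  rw [hcell]
  have hk : (0 : ℝ) ≤ k * h := by positivity
  exact wirtinger_exp hkt hh (by linarith) hα hf.continuousOn hg.continuousOn
    fun s hs => (hd s (hk.trans hs.1.le)).mono Ioi_subset_Ici_self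

/-- The supply rate of the sampling error of the signal `f` under the delay `q h`: it is positive
when the error `f (t_k - q h) - f (s - q h)` is large compared with the velocity `g = f'`, and by
Wirtinger's inequality its integral is bounded above, up to a transient. -/
def samplingSupply (α h : ℝ) (q : ℕ) (f g : ℝ → F) (s : ℝ) : ℝ :=
  Real.pi ^ 2 / 4 *
      (Real.exp (2 * α * (s - q * h)) * ‖f (s - q * h) - f (sampleTime h s - q * h)‖ ^ 2) -
    h ^ 2 * Real.exp (2 * α * h) * (Real.exp (2 * α * s) * ‖g s‖ ^ 2)

theorem isLocBdd_samplingSupply {f g : ℝ → F} (hh : 0 < h) (hf : Continuous f)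
    (hg : Continuous g) (q : ℕ) : IsLocBdd (samplingSupply α h q f g) := by
  refine .sub (.continuous_mul continuous_const (.continuous_mul (by fun_prop) (.norm_sq (.sub
    (.of_continuous (by fun_prop)) ?_)))) (.of_continuous (by fun_prop))
  exact .comp_sampleTime hh fun s => f (s - q * h)

theorem integral_samplingSupply_le (hh : 0 < h) (hα : 0 ≤ α) (hf : Continuous f)
    (hg : Continuous g) (hd : ∀ t, 0 ≤ t → HasDerivWithinAt f (g t) (Ici t) t) {q N : ℕ}
    (hq : q ≤ N) {t : ℝ} (ht : N * h ≤ t) :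
    ∫ s in (N * h)..t, samplingSupply α h q f g s ≤
      h ^ 2 * Real.exp (2 * α * h) *
        ∫ s in (N * h - q * h)..(N * h), Real.exp (2 * α * s) * ‖g s‖ ^ 2 := by
  have hcont : Continuous fun s => Real.exp (2 * α * s) * ‖g s‖ ^ 2 := by fun_prop
  have hqh : (0 : ℝ) ≤ q * h := by positivity
  have hNq : ((N - q : ℕ) : ℝ) * h = N * h - q * h := by rw [Nat.cast_sub hq, sub_mul]
  have hshift : ∫ s in (N * h)..t, Real.exp (2 * α * (s - q * h)) *
        ‖f (s - q * h) - f (sampleTime h s - q * h)‖ ^ 2 =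
      ∫ s in (N * h - q * h)..(t - q * h),
        Real.exp (2 * α * s) * ‖f s - f (sampleTime h s)‖ ^ 2 := by
    rw [← integral_comp_sub_right (fun s => Real.exp (2 * α * s) *
      ‖f s - f (sampleTime h s)‖ ^ 2)]
    refine integral_congr fun s hs => ?_
    rw [uIcc_of_le ht] at hs
    have hqN : (q : ℝ) * h ≤ N * h := by gcongr
    simp only [sampleTime_sub hh (hqN.trans hs.1)]
  have hW := wirtinger_sampleTime (t := t - q * h) hh hα hf hg hd (N - q) (by linarith)
  rw [hNq, ← hshift] at hW
  have hmono : ∫ s in (N * h - q * h)..(t - q * h), Real.exp (2 * α * s) * ‖g s‖ ^ 2 ≤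
      ∫ s in (N * h - q * h)..t, Real.exp (2 * α * s) * ‖g s‖ ^ 2 :=
    integral_mono_interval le_rfl (by linarith) (by linarith)
      (Eventually.of_forall fun s => by positivity) (hcont.intervalIntegrable _ _)
  have hsplit := integral_add_adjacent_intervals (hcont.intervalIntegrable (N * h - q * h) (N * h))
    (hcont.intervalIntegrable (N * h) t) (μ := volume)
  have herr : IsLocBdd fun s => Real.exp (2 * α * (s - q * h)) *
      ‖f (s - q * h) - f (sampleTime h s - q * h)‖ ^ 2 :=
    .continuous_mul (by fun_prop) (.norm_sq (.sub (.of_continuous (by fun_prop))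
      (.comp_sampleTime hh fun s => f (s - q * h))))
  simp only [samplingSupply]
  rw [integral_sub ((herr.intervalIntegrable _ _).const_mul _)
    ((hcont.intervalIntegrable _ _).const_mul _), intervalIntegral.integral_const_mul,
    intervalIntegral.integral_const_mul]
  have hmul := mul_le_mul_of_nonneg_left (hmono.trans_eq hsplit.symm)
    (show 0 ≤ h ^ 2 * Real.exp (2 * α * h) by positivity)
  linarith

end Wirtinger

section TaylorRemainder

variable [NormedSpace ℝ F] {f : ℕ → ℝ → F} {k : ℕ} {η : ℝ}

/-- The remainder of the Taylor polynomial of order `r - 1` based at `s`, evaluated at `s - η`. The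
functions `f j` play the role of the successive derivatives of `f 0`; they are data because the
signals of a sampled-data loop only have right derivatives at the sampling instants. -/
def taylorRem (r : ℕ) (f : ℕ → ℝ → F) (η s : ℝ) : F :=
  f 0 (s - η) - ∑ j ∈ Finset.range r, ((-η) ^ j / (j ! : ℝ)) • f j s

/-- The integral of `G` over the window `[s - η, s]` against the weight `(t - (s - η)) ^ k`. -/
def movingAverage (k : ℕ) (η : ℝ) (G : ℝ → ℝ) (s : ℝ) : ℝ :=
  ∫ θ in (0 : ℝ)..η, θ ^ k * G (s - η + θ)

theorem hasDerivWithinAt_taylor_sum {t σ : ℝ} {S : Set ℝ}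
    (hd : ∀ j ≤ k, HasDerivWithinAt (f j) (f (j + 1) t) S t) :
    HasDerivWithinAt (fun τ => ∑ j ∈ Finset.range (k + 1), ((σ - τ) ^ j / (j ! : ℝ)) • f j τ)
      (((σ - t) ^ k / (k ! : ℝ)) • f (k + 1) t) S t := by
  induction k with
  | zero => simpa using hd 0 le_rfl
  | succ k ih =>
    have hcoeff : HasDerivWithinAt (fun τ => (σ - τ) ^ (k + 1) / ((k + 1)! : ℝ))
        (-((σ - t) ^ k / (k ! : ℝ))) S t := by
      refine (((((hasDerivAt_id t).const_sub σ).pow (k + 1)).div_const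
        ((k + 1)! : ℝ)).hasDerivWithinAt).congr_deriv ?_
      rw [Nat.factorial_succ, id, Nat.add_sub_cancel]
      push_cast
      field_simp
    have hstep := (ih fun j hj => hd j (hj.trans k.le_succ)).add (hcoeff.smul (hd (k + 1) le_rfl))
    simp only [Finset.sum_range_succ _ (k + 1)]
    refine hstep.congr_deriv ?_
    rw [neg_smul, add_comm (_ • _) (-_), add_neg_cancel_left]

theorem continuous_taylorRem {r : ℕ} (hr : 0 < r) (hf : ∀ j < r, Continuous (f j)) :
    Continuous (taylorRem r f η) :=
  ((hf 0 hr).comp (by fun_prop)).sub <| continuous_finsetSum _ fun j hj =>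
    (hf j (Finset.mem_range.1 hj)).const_smul _

theorem taylorRem_eq_integral [CompleteSpace F] {s : ℝ} (hη : 0 ≤ η) (hs : η ≤ s)
    (hf : ∀ j ≤ k, Continuous (f j))
    (hd : ∀ j ≤ k, ∀ t, 0 ≤ t → HasDerivWithinAt (f j) (f (j + 1) t) (Ici t) t)
    (hbdd : IsLocBdd (f (k + 1))) :
    taylorRem (k + 1) f η s =
      -∫ θ in (0 : ℝ)..η, ((-θ) ^ k / (k ! : ℝ)) • f (k + 1) (s - η + θ) := by
  have hFTC := integral_eq_sub_of_hasDeriv_right_of_le (a := s - η) (b := s)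
    (f := fun τ => ∑ j ∈ Finset.range (k + 1), ((s - η - τ) ^ j / (j ! : ℝ)) • f j τ)
    (f' := fun t => ((s - η - t) ^ k / (k ! : ℝ)) • f (k + 1) t) (by linarith)
    (continuous_finsetSum _ fun j hj => Continuous.smul (by fun_prop)
      (hf j (Finset.mem_range_succ_iff.1 hj))).continuousOn
    (fun t ht => (hasDerivWithinAt_taylor_sum fun j hj => hd j hj t (by linarith [ht.1])).mono
      Ioi_subset_Ici_self)
    (((IsLocBdd.of_continuous (by fun_prop)).smul hbdd).intervalIntegrable _ _)
  have hshift := integral_comp_add_left (a := 0) (b := η)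
    (fun t => ((s - η - t) ^ k / (k ! : ℝ)) • f (k + 1) t) (s - η)
  simp only [sub_add_cancel_left, add_zero, sub_add_cancel] at hshift
  rw [hshift, hFTC, taylorRem, neg_sub]
  simp only [sub_sub_cancel_left, sub_self]
  congr 1
  rw [Finset.sum_range_succ', Finset.sum_eq_zero] <;> simp

theorem sq_integral_mul_le {ρ g : ℝ → ℝ} {a b : ℝ} (hab : a ≤ b) (hρ : Continuous ρ)
    (hg : IsLocBdd g) (hρ0 : ∀ t ∈ Icc a b, 0 ≤ ρ t) :
    (∫ t in a..b, ρ t * g t) ^ 2 ≤ (∫ t in a..b, ρ t) * ∫ t in a..b, ρ t * g t ^ 2 := by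
  have hρint := hρ.intervalIntegrable (μ := volume) a b
  have hρg := (IsLocBdd.continuous_mul hρ hg).intervalIntegrable a b
  have hρg2 := (IsLocBdd.continuous_mul hρ (g := fun t => g t ^ 2)
    (by simpa only [pow_two] using hg.mul hg)).intervalIntegrable a b
  have hdiscrim := discrim_le_zero (a := ∫ t in a..b, ρ t) (b := -2 * ∫ t in a..b, ρ t * g t)
    (c := ∫ t in a..b, ρ t * g t ^ 2) fun x => by
      have hx : 0 ≤ ∫ t in a..b, (x * x * ρ t + -2 * x * (ρ t * g t) + ρ t * g t ^ 2) :=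
        integral_nonneg hab fun t ht => by
          linear_combination mul_nonneg (hρ0 t ht) (sq_nonneg (g t - x))
      rw [intervalIntegral.integral_add ((hρint.const_mul _).add (hρg.const_mul _)) hρg2,
        intervalIntegral.integral_add (hρint.const_mul _) (hρg.const_mul _),
        intervalIntegral.integral_const_mul, intervalIntegral.integral_const_mul] at hx
      linear_combination hx
  rw [discrim] at hdiscrim
  linear_combination hdiscrim / 4

theorem norm_taylorRem_sq_le [CompleteSpace F] {s : ℝ} (hη : 0 ≤ η) (hs : η ≤ s)
    (hf : ∀ j ≤ k, Continuous (f j))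
    (hd : ∀ j ≤ k, ∀ t, 0 ≤ t → HasDerivWithinAt (f j) (f (j + 1) t) (Ici t) t)
    (hbdd : IsLocBdd (f (k + 1))) :
    ((k + 1)! : ℝ) ^ 2 * ‖taylorRem (k + 1) f η s‖ ^ 2 ≤
      η ^ (k + 1) * ((k + 1) * movingAverage k η (fun t => ‖f (k + 1) t‖ ^ 2) s) := by
  set J := movingAverage k η (fun t => ‖f (k + 1) t‖ ^ 2) s
  have hshifted : IsLocBdd fun θ => f (k + 1) (s - η + θ) := by
    simpa only [sub_sub_eq_add_sub, sub_neg_eq_add, add_comm] using hbdd.comp_sub (-(s - η))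
  have hnorm : IsLocBdd fun θ => ‖f (k + 1) (s - η + θ)‖ :=
    ⟨hshifted.1.norm, by simpa only [norm_norm] using hshifted.2⟩
  have hrem : (k ! : ℝ) * ‖taylorRem (k + 1) f η s‖ ≤
      ∫ θ in (0 : ℝ)..η, θ ^ k * ‖f (k + 1) (s - η + θ)‖ := by
    rw [taylorRem_eq_integral hη hs hf hd hbdd, norm_neg, ← le_div_iff₀' (by positivity),
      ← intervalIntegral.integral_div]
    refine (intervalIntegral.norm_integral_le_integral_norm hη).trans_eq ?_
    refine integral_congr fun θ hθ => ?_
    rw [uIcc_of_le hη] at hθ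
    simp only [norm_smul, norm_div, norm_pow, norm_neg, Real.norm_of_nonneg hθ.1, Real.norm_natCast]
    ring
  have hJensen := sq_integral_mul_le (ρ := fun θ => θ ^ k) hη (by fun_prop) hnorm
    fun θ hθ => pow_nonneg hθ.1 k
  rw [integral_pow, zero_pow k.succ_ne_zero, sub_zero] at hJensen
  calc _ = ((k + 1 : ℕ) : ℝ) ^ 2 * ((k ! : ℝ) * ‖taylorRem (k + 1) f η s‖) ^ 2 := by
        rw [Nat.factorial_succ]; push_cast; ring
    _ ≤ ((k + 1 : ℕ) : ℝ) ^ 2 * (∫ θ in (0 : ℝ)..η, θ ^ k * ‖f (k + 1) (s - η + θ)‖) ^ 2 := by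
        gcongr
    _ ≤ ((k + 1 : ℕ) : ℝ) ^ 2 * (η ^ (k + 1) / (k + 1) * J) := by gcongr; exact hJensen
    _ = _ := by push_cast; field_simp

theorem integrableOn_movingAverage {G : ℝ → ℝ} (hG : IsLocBdd G) {a b : ℝ} (hab : a ≤ b)
    (hη : 0 ≤ η) :
    IntegrableOn (Function.uncurry fun s θ => θ ^ k * G (s - η + θ)) (uIoc a b ×ˢ uIoc 0 η) := by
  obtain ⟨c, hc⟩ := hG.2 (|a| + |b| + 2 * η)
  rw [uIoc_of_le hab, uIoc_of_le hη]
  refine Measure.integrableOn_of_bounded (M := η ^ k * c) ?_ ?_ ?_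
  · rw [Measure.volume_eq_prod, Measure.prod_prod]
    exact (ENNReal.mul_lt_top measure_Ioc_lt_top measure_Ioc_lt_top).ne
  · have := hG.1.measurable
    exact Measurable.aestronglyMeasurable (by fun_prop)
  · filter_upwards [ae_restrict_mem (measurableSet_Ioc.prod measurableSet_Ioc)] with
      ⟨s, θ⟩ ⟨⟨has, hsb⟩, hθ0, hθη⟩
    have hGc : ‖G (s - η + θ)‖ ≤ c := hc _ <| abs_le.2
      ⟨by linarith [neg_abs_le a, abs_nonneg b], by linarith [le_abs_self b, abs_nonneg a]⟩
    rw [Function.uncurry_apply_pair, norm_mul, norm_pow, Real.norm_of_nonneg hθ0.le]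
    gcongr

theorem intervalIntegrable_movingAverage {G : ℝ → ℝ} (hG : IsLocBdd G) {a b : ℝ} (hab : a ≤ b)
    (hη : 0 ≤ η) : IntervalIntegrable (movingAverage k η G) volume a b := by
  have hint := integrableOn_movingAverage (k := k) hG hab hη
  rw [uIoc_of_le hab, uIoc_of_le hη, IntegrableOn, Measure.volume_eq_prod,
    ← Measure.prod_restrict] at hint
  unfold movingAverage
  simp only [intervalIntegrable_iff_integrableOn_Ioc_of_le hab, integral_of_le hη]
  exact hint.integral_prod_left

theorem integral_movingAverage_le {G : ℝ → ℝ} (hG : IsLocBdd G) (hG0 : ∀ t, 0 ≤ G t) {a b : ℝ}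
    (hab : a ≤ b) (hη : 0 ≤ η) :
    (k + 1) * ∫ s in a..b, movingAverage k η G s ≤ η ^ (k + 1) * ∫ s in (a - η)..b, G s := by
  have hslice : ∀ θ ∈ Icc 0 η, ∫ s in a..b, θ ^ k * G (s - η + θ) ≤
      θ ^ k * ∫ s in (a - η)..b, G s := fun θ hθ => by
    rw [intervalIntegral.integral_const_mul]
    simp only [sub_add]
    rw [integral_comp_sub_right G (η - θ)]
    refine mul_le_mul_of_nonneg_left ?_ (pow_nonneg hθ.1 k)
    exact integral_mono_interval (by linarith [hθ.1]) (by linarith) (by linarith [hθ.2])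
      (Eventually.of_forall hG0) (hG.intervalIntegrable _ _)
  have hint := integrableOn_movingAverage (k := k) hG hab hη
  have hsliceint : IntervalIntegrable (fun θ => ∫ s in a..b, θ ^ k * G (s - η + θ)) volume 0 η := by
    rw [uIoc_of_le hab, uIoc_of_le hη, IntegrableOn, Measure.volume_eq_prod,
      ← Measure.prod_restrict] at hint
    simp only [intervalIntegrable_iff_integrableOn_Ioc_of_le hη, integral_of_le hab]
    exact hint.integral_prod_right
  calc (k + 1) * ∫ s in a..b, movingAverage k η G s
      = (k + 1) * ∫ θ in (0 : ℝ)..η, ∫ s in a..b, θ ^ k * G (s - η + θ) := by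
        rw [← intervalIntegral_intervalIntegral_swap hint]; rfl
    _ ≤ (k + 1) * ∫ θ in (0 : ℝ)..η, θ ^ k * ∫ s in (a - η)..b, G s := by
        gcongr
        exact integral_mono_on hη hsliceint (Continuous.intervalIntegrable (by fun_prop) _ _) hslice
    _ = η ^ (k + 1) * ∫ s in (a - η)..b, G s := by
        rw [intervalIntegral.integral_mul_const, integral_pow, zero_pow k.succ_ne_zero]
        field_simp
        ring

theorem exp_mul_movingAverage_le {G : ℝ → ℝ} (hG : IsLocBdd G) (hG0 : ∀ t, 0 ≤ G t) {α : ℝ}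
    (hα : 0 ≤ α) (hη : 0 ≤ η) (s : ℝ) :
    Real.exp (2 * α * (s - η)) * movingAverage k η G s ≤
      movingAverage k η (fun t => Real.exp (2 * α * t) * G t) s := by
  have hshift : IsLocBdd fun θ => G (s - η + θ) := by
    simpa only [sub_sub_eq_add_sub, sub_neg_eq_add, add_comm] using hG.comp_sub (-(s - η))
  rw [movingAverage, movingAverage, ← intervalIntegral.integral_const_mul]
  refine integral_mono_on hη ((IsLocBdd.continuous_mul (by fun_prop)
    (.continuous_mul (by fun_prop) hshift)).intervalIntegrable _ _)
    ((IsLocBdd.continuous_mul (by fun_prop)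
      (.continuous_mul (by fun_prop) hshift)).intervalIntegrable _ _) fun θ hθ => ?_
  have hexp : Real.exp (2 * α * (s - η)) ≤ Real.exp (2 * α * (s - η + θ)) := by
    gcongr; linarith [hθ.1]
  rw [mul_left_comm]
  exact mul_le_mul_of_nonneg_left (mul_le_mul_of_nonneg_right hexp (hG0 _)) (pow_nonneg hθ.1 k)

/-- The supply rate of the Taylor remainder of order `r` of the signal `f 0` under the delay `η`,
the analogue of `samplingSupply` for the approximation of derivatives by delayed values. -/
def delaySupply (α η : ℝ) (r : ℕ) (f : ℕ → ℝ → F) (s : ℝ) : ℝ :=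
  (r ! : ℝ) ^ 2 / η ^ r * (Real.exp (2 * α * (s - η)) * ‖taylorRem r f η s‖ ^ 2) -
    η ^ r * (Real.exp (2 * α * s) * ‖f r s‖ ^ 2)

theorem isLocBdd_delaySupply {r : ℕ} {α : ℝ} (hr : 0 < r) (hf : ∀ j < r, Continuous (f j))
    (hbdd : IsLocBdd (f r)) : IsLocBdd (delaySupply α η r f) :=
  .sub (.of_continuous (by have := continuous_taylorRem (η := η) hr hf; fun_prop))
    (.continuous_mul continuous_const (.continuous_mul (by fun_prop) hbdd.norm_sq))

theorem integral_delaySupply_le [CompleteSpace F] {α T t : ℝ} (hη : 0 < η) (hα : 0 ≤ α)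
    (hf : ∀ j ≤ k, Continuous (f j))
    (hd : ∀ j ≤ k, ∀ t, 0 ≤ t → HasDerivWithinAt (f j) (f (j + 1) t) (Ici t) t)
    (hbdd : IsLocBdd (f (k + 1))) (hT : η ≤ T) (ht : T ≤ t) :
    ∫ s in T..t, delaySupply α η (k + 1) f s ≤
      η ^ (k + 1) * ∫ s in (T - η)..T, Real.exp (2 * α * s) * ‖f (k + 1) s‖ ^ 2 := by
  set G : ℝ → ℝ := fun s => Real.exp (2 * α * s) * ‖f (k + 1) s‖ ^ 2
  have hG : IsLocBdd G := .continuous_mul (by fun_prop) hbdd.norm_sq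
  have hpointwise : ∀ s ∈ Icc T t, delaySupply α η (k + 1) f s ≤
      (k + 1) * movingAverage k η G s - η ^ (k + 1) * G s := fun s hs => by
    refine sub_le_sub_right ?_ _
    calc _ = Real.exp (2 * α * (s - η)) / η ^ (k + 1) *
          (((k + 1)! : ℝ) ^ 2 * ‖taylorRem (k + 1) f η s‖ ^ 2) := by ring
      _ ≤ Real.exp (2 * α * (s - η)) / η ^ (k + 1) * (η ^ (k + 1) *
          ((k + 1) * movingAverage k η (fun t => ‖f (k + 1) t‖ ^ 2) s)) := by
        gcongr _ * ?_
        exact norm_taylorRem_sq_le hη.le (hT.trans hs.1) hf hd hbdd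
      _ = (k + 1) * (Real.exp (2 * α * (s - η)) *
          movingAverage k η (fun t => ‖f (k + 1) t‖ ^ 2) s) := by field_simp
      _ ≤ _ := by
        gcongr
        exact exp_mul_movingAverage_le hbdd.norm_sq (fun _ => sq_nonneg _) hα hη.le s
  have hmono := integral_mono_on ht ((isLocBdd_delaySupply k.succ_pos
    (fun j hj => hf j (Nat.le_of_lt_succ hj)) hbdd).intervalIntegrable _ _)
    (((intervalIntegrable_movingAverage hG ht hη.le).const_mul _).sub
      ((hG.intervalIntegrable _ _).const_mul _)) hpointwise
  rw [intervalIntegral.integral_sub ((intervalIntegrable_movingAverage hG ht hη.le).const_mul _)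
    ((hG.intervalIntegrable _ _).const_mul _), intervalIntegral.integral_const_mul,
    intervalIntegral.integral_const_mul] at hmono
  have hsplit := integral_add_adjacent_intervals (hG.intervalIntegrable (T - η) T)
    (hG.intervalIntegrable T t)
  have hwindow := integral_movingAverage_le (k := k) hG (fun s => by positivity) ht hη.le
  rw [← hsplit, mul_add] at hwindow
  linarith

end TaylorRemainder
section Flow

variable {X Y : Type*} [NormedAddCommGroup X] [NormedSpace ℝ X] [NormedAddCommGroup Y]
  [NormedSpace ℝ Y]

theorem IsLocBdd.clm_apply {L : ℝ → X →L[ℝ] Y} {f : ℝ → X} (hL : Continuous L)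
    (hf : IsLocBdd f) : IsLocBdd (fun t => L t (f t)) := by
  refine ⟨isBoundedBilinearMap_apply.continuous.comp_stronglyMeasurable
    (hL.stronglyMeasurable.prodMk hf.1), fun b => ?_⟩
  obtain ⟨c, hc⟩ := (of_continuous hL).2 b
  obtain ⟨d, hd⟩ := hf.2 b
  exact ⟨c * d, fun t ht => (L t).le_of_opNorm_le_of_le (hc t ht) (hd t ht)⟩

/-- The flow `e^{t A}` of the linear equation `x' = A x`. -/
def flow (A : X →L[ℝ] X) (t : ℝ) : X →L[ℝ] X := NormedSpace.exp (t • A)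

theorem flow_zero (A : X →L[ℝ] X) : flow A 0 = 1 := by
  rw [flow, zero_smul, NormedSpace.exp_zero]

variable (A : X →L[ℝ] X)

theorem flow_apply_comm (t : ℝ) (v : X) : flow A t (A v) = A (flow A t v) :=
  DFunLike.congr_fun (((Commute.refl A).smul_right t).exp_right).eq.symm v

/-- Duhamel's formula for the solution of `x' = A x + f`, `x 0 = x₀`. -/
def duhamel (f : ℝ → X) (x₀ : X) (t : ℝ) : X :=
  flow A t (x₀ + ∫ s in (0 : ℝ)..t, flow A (-s) (f s))

variable {f g : ℝ → X} {t : ℝ}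

theorem duhamel_zero (f : ℝ → X) (x₀ : X) : duhamel A f x₀ 0 = x₀ := by
  simp [duhamel, flow_zero]

theorem duhamel_congr (ht : 0 ≤ t) (hfg : ∀ s ∈ Ioo 0 t, f s = g s) (x₀ : X) :
    duhamel A f x₀ t = duhamel A g x₀ t := by
  rw [duhamel, duhamel, integral_congr_Ioo_of_le ht fun s hs => by rw [hfg s hs]]

variable [CompleteSpace X]

theorem hasDerivAt_flow (t : ℝ) : HasDerivAt (flow A) (A * flow A t) t :=
  hasDerivAt_exp_smul_const' A t

theorem continuous_flow : Continuous (flow A) :=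
  continuous_iff_continuousAt.2 fun t => (hasDerivAt_flow A t).continuousAt

theorem hasDerivAt_flow_apply (v : X) (t : ℝ) :
    HasDerivAt (fun s => flow A s v) (A (flow A t v)) t := by
  simpa using (hasDerivAt_flow A t).clm_apply (hasDerivAt_const t v)

theorem flow_apply_flow_neg (t : ℝ) (v : X) : flow A t (flow A (-t) v) = v := by
  have hinv : flow A t * flow A (-t) = 1 := by
    rw [flow, flow, neg_smul]
    let : NormedAlgebra ℚ (X →L[ℝ] X) := .restrictScalars ℚ ℝ _
    exact (NormedSpace.invertibleExp (t • A)).mul_invOf_self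
  exact DFunLike.congr_fun hinv v

theorem isLocBdd_flow_neg_apply (hf : IsLocBdd f) : IsLocBdd fun s => flow A (-s) (f s) :=
  hf.clm_apply ((continuous_flow A).comp continuous_neg)

theorem continuous_duhamel (hf : IsLocBdd f) (x₀ : X) : Continuous (duhamel A f x₀) :=
  (continuous_flow A).clm_apply (continuous_const.add
    (continuous_primitive (fun a b => (isLocBdd_flow_neg_apply A hf).intervalIntegrable a b) 0))

theorem hasDerivWithinAt_duhamel (hf : IsLocBdd f) (hft : ContinuousWithinAt f (Ici t) t)
    (x₀ : X) : HasDerivWithinAt (duhamel A f x₀) (A (duhamel A f x₀ t) + f t) (Ici t) t := by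
  have hloc := isLocBdd_flow_neg_apply A hf
  have hcont : ContinuousWithinAt (fun s => flow A (-s) (f s)) (Ici t) t :=
    ((continuous_flow A).comp continuous_neg).continuousWithinAt.clm_apply hft
  have hprim := (integral_hasDerivWithinAt_right (s := Ici t) (t := Ioi t)
    (hloc.intervalIntegrable 0 t) hloc.1.stronglyMeasurableAtFilter
    (hcont.mono Ioi_subset_Ici_self)).const_add x₀
  refine ((hasDerivAt_flow A t).hasDerivWithinAt.clm_apply hprim).congr_deriv ?_
  rw [flow_apply_flow_neg]
  rfl

end Flow

section Existence

variable {n m l : ℕ}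

/-- The continuous linear map `v ↦ M *ᵥ v`, which makes operator-norm bounds and the calculus of
continuous linear maps available for matrices. -/
def mulVecCLM {k : ℕ} (M : Matrix (Fin m) (Fin k) ℝ) : (Fin k → ℝ) →L[ℝ] (Fin m → ℝ) :=
  M.mulVecLin.toContinuousLinearMap

theorem mulVecCLM_apply {k : ℕ} (M : Matrix (Fin m) (Fin k) ℝ) (v : Fin k → ℝ) :
    mulVecCLM M v = M *ᵥ v := rfl

theorem norm_mulVec_le {k : ℕ} (M : Matrix (Fin m) (Fin k) ℝ) (v : Fin k → ℝ) :
    ‖M *ᵥ v‖ ≤ ‖mulVecCLM M‖ * ‖v‖ :=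
  (mulVecCLM M).le_opNorm v

theorem exists_causal_fixedPoint {β : Type*} [Inhabited β] (G : (ℕ → β) → ℕ → β)
    (hG : ∀ k w w', (∀ j < k, w j = w' j) → G w k = G w' k) : ∃ w : ℕ → β, ∀ k, w k = G w k := by
  let w : ℕ → β := fun k => Nat.strongRec (motive := fun _ => β)
    (fun k ih => G (fun j => if hj : j < k then ih j hj else default) k) k
  have hrec : ∀ k, w k = G (fun j => if j < k then w j else default) k := fun k => by
    simp only [w]
    rw [Nat.strongRec]
    simp only [dite_eq_ite]
  exact ⟨w, fun k => (hrec k).trans (hG _ _ _ fun j hj => if_pos hj)⟩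

theorem eventually_floor_div_eq {h t : ℝ} (hh : 0 < h) (ht : 0 ≤ t) :
    ∀ᶠ s in 𝓝[≥] t, ⌊s / h⌋₊ = ⌊t / h⌋₊ := by
  have hlt : t < (⌊t / h⌋₊ + 1) * h := (div_lt_iff₀ hh).1 (Nat.lt_floor_add_one _)
  filter_upwards [Ico_mem_nhdsGE hlt] with s hs
  refine floor_div_eq hh (le_trans ?_ hs.1) hs.2
  exact sampleTime_le hh ht

theorem isTrajectory_duhamel (A : Matrix (Fin n) (Fin n) ℝ) (B : Matrix (Fin n) (Fin m) ℝ)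
    {h : ℝ} (hh : 0 < h) (w : ℕ → Fin m → ℝ) (x₀ : Fin n → ℝ) :
    IsTrajectory A B (fun t => w ⌊t / h⌋₊)
      (duhamel (mulVecCLM A) (fun t => B *ᵥ w ⌊t / h⌋₊) x₀) := by
  have hloc : IsLocBdd fun t => B *ᵥ w ⌊t / h⌋₊ := .comp_floor hh fun k => B *ᵥ w k
  refine ⟨(continuous_duhamel _ hloc x₀).continuousOn, fun t ht =>
    hasDerivWithinAt_duhamel _ hloc ?_ x₀⟩
  refine continuousWithinAt_const.congr_of_eventuallyEq (f := fun _ => B *ᵥ w ⌊t / h⌋₊) ?_ rfl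
  filter_upwards [eventually_floor_div_eq hh ht] with s hs
  rw [hs]

theorem exists_isSampledLoop (A : Matrix (Fin n) (Fin n) ℝ)
    (B : Matrix (Fin n) (Fin m) ℝ) (C : Matrix (Fin l) (Fin n) ℝ) (r : ℕ) {h : ℝ} (hh : 0 < h)
    (q : ℕ → ℕ) (K : ℕ → Matrix (Fin m) (Fin l) ℝ) (x₀ : Fin n → ℝ) :
    ∃ x, IsSampledLoop A B C r h q K x ∧ x 0 = x₀ := by
  let sol (w : ℕ → Fin m → ℝ) := duhamel (mulVecCLM A) (fun t => B *ᵥ w ⌊t / h⌋₊) x₀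
  obtain ⟨w, hw⟩ := exists_causal_fixedPoint (fun (w : ℕ → Fin m → ℝ) (k : ℕ) =>
      ∑ i ∈ Finset.range r, K i *ᵥ output C (sol w) (k * h - q i * h))
    fun k w w' hww' => Finset.sum_congr rfl fun i _ => by
      unfold output
      split_ifs with hpos
      · have hcongr : sol w (k * h - q i * h) = sol w' (k * h - q i * h) := by
          refine duhamel_congr _ hpos (fun s hs => ?_) x₀
          have hsk : s < k * h := hs.2.trans_le (sub_le_self _ (by positivity))
          rw [hww' _ ((Nat.floor_lt (div_nonneg hs.1.le hh.le)).2 ((div_lt_iff₀ hh).2 hsk))]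
        rw [hcongr]
      · rfl
  refine ⟨sol w, ⟨_, isTrajectory_duhamel A B hh w x₀, fun k t ht => ?_⟩, duhamel_zero _ _ x₀⟩
  simp only [floor_div_eq hh ht.1 ht.2]
  exact hw k

end Existence
section ClosedLoop

variable {n m l : ℕ}

theorem gainRow_mulVec (r : ℕ) (K : ℕ → Matrix (Fin m) (Fin l) ℝ) (z : Fin l × Fin r → ℝ) :
    gainRow r K *ᵥ z = ∑ i : Fin r, K i *ᵥ fun b => z (b, i) := by
  funext a
  simp only [Matrix.mulVec, dotProduct, gainRow, Matrix.of_apply, Finset.sum_apply,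
    Fintype.sum_prod_type]
  exact Finset.sum_comm

theorem vandermondeM_mulVec (r : ℕ) (h : ℝ) (q : ℕ → ℕ) (z : Fin l × Fin r → ℝ) (b : Fin l)
    (i : Fin r) : (vandermondeM l r h q *ᵥ z) (b, i) =
      ∑ j : Fin r, (-((q i : ℝ) * h)) ^ (j : ℕ) / ((j : ℕ)! : ℝ) * z (b, j) := by
  simp only [Matrix.mulVec, dotProduct, vandermondeM, Matrix.of_apply, Fintype.sum_prod_type]
  rw [Finset.sum_eq_single b (fun c _ hc => by simp [Matrix.one_apply_ne hc.symm]) (by simp)]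
  simp

theorem feedback_mulVec (A : Matrix (Fin n) (Fin n) ℝ) (C : Matrix (Fin l) (Fin n) ℝ) (r : ℕ)
    (h : ℝ) (q : ℕ → ℕ) (K : ℕ → Matrix (Fin m) (Fin l) ℝ) (v : Fin n → ℝ) :
    (gainRow r K * vandermondeM l r h q * outputCol A C r) *ᵥ v =
      ∑ i ∈ Finset.range r, K i *ᵥ ∑ j ∈ Finset.range r,
        ((-((q i : ℝ) * h)) ^ j / (j ! : ℝ)) • ((C * A ^ j) *ᵥ v) := by
  rw [← Matrix.mulVec_mulVec, ← Matrix.mulVec_mulVec, gainRow_mulVec, Finset.sum_range]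
  refine Finset.sum_congr rfl fun i _ => congrArg _ (funext fun b => ?_)
  rw [vandermondeM_mulVec, Finset.sum_range, Finset.sum_apply]
  rfl

/-- A trajectory, extended to negative times by its initial value. -/
def extState (x : ℝ → Fin n → ℝ) (t : ℝ) : Fin n → ℝ := x (max 0 t)

theorem extState_of_nonneg (x : ℝ → Fin n → ℝ) {t : ℝ} (ht : 0 ≤ t) : extState x t = x t := by
  rw [extState, max_eq_right ht]

/-- The input that the delayed sampled-data controller generates. -/
def heldInput (C : Matrix (Fin l) (Fin n) ℝ) (r : ℕ) (h : ℝ) (q : ℕ → ℕ)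
    (K : ℕ → Matrix (Fin m) (Fin l) ℝ) (x : ℝ → Fin n → ℝ) (t : ℝ) : Fin m → ℝ :=
  ∑ i ∈ Finset.range r, K i *ᵥ output C x (sampleTime h t - q i * h)

/-- The closed-loop velocity `A x + B u`. -/
def velocity (A : Matrix (Fin n) (Fin n) ℝ) (B : Matrix (Fin n) (Fin m) ℝ)
    (C : Matrix (Fin l) (Fin n) ℝ) (r : ℕ) (h : ℝ) (q : ℕ → ℕ)
    (K : ℕ → Matrix (Fin m) (Fin l) ℝ) (x : ℝ → Fin n → ℝ) (t : ℝ) : Fin n → ℝ :=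
  A *ᵥ extState x t + B *ᵥ heldInput C r h q K x t

/-- The output derivatives `y, y', …, y^(r)` along the closed loop, each obtained by applying
`C A^j` to the velocity; they equal `C A^j x` as long as the input does not enter. -/
def outputDeriv (A : Matrix (Fin n) (Fin n) ℝ) (B : Matrix (Fin n) (Fin m) ℝ)
    (C : Matrix (Fin l) (Fin n) ℝ) (r : ℕ) (h : ℝ) (q : ℕ → ℕ)
    (K : ℕ → Matrix (Fin m) (Fin l) ℝ) (x : ℝ → Fin n → ℝ) : ℕ → ℝ → Fin l → ℝ
  | 0, t => C *ᵥ extState x t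
  | j + 1, t => (C * A ^ j) *ᵥ velocity A B C r h q K x t

variable {A : Matrix (Fin n) (Fin n) ℝ} {B : Matrix (Fin n) (Fin m) ℝ}
  {C : Matrix (Fin l) (Fin n) ℝ} {r : ℕ} {h : ℝ} {q : ℕ → ℕ}
  {K : ℕ → Matrix (Fin m) (Fin l) ℝ} {x : ℝ → Fin n → ℝ}

theorem IsSampledLoop.continuous_extState (hx : IsSampledLoop A B C r h q K x) :
    Continuous (extState x) := by
  obtain ⟨u, ⟨hc, _⟩, _⟩ := hx
  exact hc.comp_continuous (by fun_prop) fun t => le_max_left 0 t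

theorem IsSampledLoop.hasDerivWithinAt_extState (hh : 0 < h) (hx : IsSampledLoop A B C r h q K x)
    {t : ℝ} (ht : 0 ≤ t) :
    HasDerivWithinAt (extState x) (velocity A B C r h q K x t) (Ici t) t := by
  obtain ⟨u, ⟨_, hd⟩, hu⟩ := hx
  have hut : u t = heldInput C r h q K x t :=
    hu ⌊t / h⌋₊ t ⟨sampleTime_le hh ht, (div_lt_iff₀ hh).1 (Nat.lt_floor_add_one _)⟩
  have hdt := hd t ht
  rw [hut, ← extState_of_nonneg x ht] at hdt
  exact hdt.congr (fun s hs => extState_of_nonneg x (ht.trans hs)) (extState_of_nonneg x ht)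

theorem outputDeriv_of_lt (hCB : ∀ i, i + 2 ≤ r → C * A ^ i * B = 0) {j : ℕ} (hj : j < r) :
    outputDeriv A B C r h q K x j = fun t => (C * A ^ j) *ᵥ extState x t := by
  funext t
  cases j with
  | zero => rw [outputDeriv, pow_zero, Matrix.mul_one]
  | succ j =>
    rw [outputDeriv, velocity, Matrix.mulVec_add, Matrix.mulVec_mulVec, Matrix.mulVec_mulVec,
      hCB j (by omega), Matrix.zero_mulVec, add_zero, Matrix.mul_assoc, ← pow_succ]

theorem isLocBdd_velocity (hh : 0 < h) (hx : Continuous (extState x)) :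
    IsLocBdd (velocity A B C r h q K x) :=
  .add (.of_continuous ((mulVecCLM A).continuous.comp hx)) (.comp_sampleTime hh fun t =>
    B *ᵥ ∑ i ∈ Finset.range r, K i *ᵥ output C x (t - q i * h))

/-- The error caused by sampling the `i`-th delayed measurement. -/
def samplingError (C : Matrix (Fin l) (Fin n) ℝ) (h : ℝ) (q : ℕ → ℕ)
    (K : ℕ → Matrix (Fin m) (Fin l) ℝ) (x : ℝ → Fin n → ℝ) (i : ℕ) (s : ℝ) : Fin m → ℝ :=
  K i *ᵥ (C *ᵥ extState x (sampleTime h s - q i * h) - C *ᵥ extState x (s - q i * h))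

/-- The error caused by replacing the `i`-th delayed measurement by a Taylor polynomial. -/
def delayError (A : Matrix (Fin n) (Fin n) ℝ) (C : Matrix (Fin l) (Fin n) ℝ) (r : ℕ) (h : ℝ)
    (q : ℕ → ℕ) (K : ℕ → Matrix (Fin m) (Fin l) ℝ) (x : ℝ → Fin n → ℝ) (i : ℕ) (s : ℝ) :
    Fin m → ℝ :=
  K i *ᵥ taylorRem r (fun j t => (C * A ^ j) *ᵥ extState x t) (q i * h) s

theorem delayError_eq_zero (hr : 0 < r) {i : ℕ} (hqi : q i = 0) (s : ℝ) :
    delayError A C r h q K x i s = 0 := by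
  obtain ⟨k, rfl⟩ := Nat.exists_eq_succ_of_ne_zero hr.ne'
  rw [delayError, taylorRem, Finset.sum_range_succ', Finset.sum_eq_zero] <;> simp [hqi]

theorem mulVec_output_eq_taylor_add_errors {i : ℕ} {s : ℝ} (hpos : 0 ≤ sampleTime h s - q i * h) :
    K i *ᵥ output C x (sampleTime h s - q i * h) =
      K i *ᵥ ∑ j ∈ Finset.range r,
        ((-((q i : ℝ) * h)) ^ j / (j ! : ℝ)) • ((C * A ^ j) *ᵥ extState x s) +
      samplingError C h q K x i s + delayError A C r h q K x i s := by
  rw [samplingError, delayError, taylorRem, ← Matrix.mulVec_add, ← Matrix.mulVec_add, output,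
    if_pos hpos, extState_of_nonneg x hpos, pow_zero, Matrix.mul_one]
  congr 1
  abel

theorem velocity_eq (hr : 0 < r) (hh : 0 < h) (hq0 : q 0 = 0) {N : ℕ} (hqN : ∀ i < r, q i ≤ N)
    {s : ℝ} (hs : N * h ≤ s) :
    velocity A B C r h q K x s = matD A B C r h q K *ᵥ extState x s +
      B *ᵥ ∑ i ∈ Finset.range r, samplingError C h q K x i s +
      B *ᵥ ∑ i ∈ Finset.range (r - 1), delayError A C r h q K x (i + 1) s := by
  have hpos : ∀ i ∈ Finset.range r, 0 ≤ sampleTime h s - q i * h := fun i hi => by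
    have hqi : (q i : ℝ) * h ≤ N * h := by gcongr; exact hqN i (Finset.mem_range.1 hi)
    exact sub_nonneg.2 (hqi.trans (le_sampleTime hh hs))
  have hdelay : ∑ i ∈ Finset.range (r - 1), delayError A C r h q K x (i + 1) s =
      ∑ i ∈ Finset.range r, delayError A C r h q K x i s := by
    obtain ⟨k, rfl⟩ := Nat.exists_eq_succ_of_ne_zero hr.ne'
    rw [Finset.sum_range_succ', delayError_eq_zero hr hq0, add_zero, Nat.succ_sub_one]
  rw [velocity, heldInput, Finset.sum_congr rfl fun i hi =>
    mulVec_output_eq_taylor_add_errors (A := A) (r := r) (hpos i hi), Finset.sum_add_distrib,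
    Finset.sum_add_distrib, hdelay, matD, Matrix.add_mulVec, ← Matrix.mulVec_mulVec,
    feedback_mulVec, Matrix.mulVec_add, Matrix.mulVec_add]
  abel

section Transient

/-- The norm of the map from past outputs to the input. -/
def feedbackNorm (C : Matrix (Fin l) (Fin n) ℝ) (r : ℕ) (K : ℕ → Matrix (Fin m) (Fin l) ℝ) : ℝ :=
  ∑ i ∈ Finset.range r, ‖mulVecCLM (K i * C)‖

theorem feedbackNorm_nonneg (C : Matrix (Fin l) (Fin n) ℝ) (r : ℕ)
    (K : ℕ → Matrix (Fin m) (Fin l) ℝ) : 0 ≤ feedbackNorm C r K :=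
  Finset.sum_nonneg fun _ _ => norm_nonneg _

theorem norm_heldInput_le (hh : 0 < h) {t M : ℝ} (hM : 0 ≤ M)
    (hx : ∀ s, 0 ≤ s → s ≤ sampleTime h t → ‖x s‖ ≤ M) :
    ‖heldInput C r h q K x t‖ ≤ feedbackNorm C r K * M := by
  rw [heldInput, feedbackNorm, Finset.sum_mul]
  refine norm_sum_le_of_le _ fun i _ => ?_
  unfold output
  split_ifs with hpos
  · rw [Matrix.mulVec_mulVec]
    refine (norm_mulVec_le _ _).trans (mul_le_mul_of_nonneg_left (hx _ hpos ?_) (norm_nonneg _))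
    exact sub_le_self _ (by positivity)
  · rw [Matrix.mulVec_zero, norm_zero]
    positivity

theorem norm_velocity_le {t M M' : ℝ} (hh : 0 < h) (ht : 0 ≤ t) (hM : 0 ≤ M)
    (hx : ∀ s, 0 ≤ s → s ≤ sampleTime h t → ‖x s‖ ≤ M) (hxt : ‖x t‖ ≤ M') :
    ‖velocity A B C r h q K x t‖ ≤
      ‖mulVecCLM A‖ * M' + ‖mulVecCLM B‖ * feedbackNorm C r K * M := by
  rw [velocity, extState_of_nonneg x ht, mul_assoc]
  refine norm_add_le_of_le ((norm_mulVec_le _ _).trans ?_) ((norm_mulVec_le _ _).trans ?_)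
  · gcongr
  · gcongr
    exact norm_heldInput_le hh hM hx

theorem gronwallBound_mul (M δ k ε t : ℝ) :
    gronwallBound (M * δ) k (M * ε) t = M * gronwallBound δ k ε t := by
  unfold gronwallBound
  split_ifs <;> ring

theorem IsSampledLoop.norm_le_of_norm_le (hh : 0 < h) (hx : IsSampledLoop A B C r h q K x) {k : ℕ}
    {M : ℝ} (hM : ∀ t, 0 ≤ t → t ≤ k * h → ‖x t‖ ≤ M) {t : ℝ} (hkt : k * h ≤ t)
    (htk : t ≤ (k + 1) * h) :
    ‖x t‖ ≤ gronwallBound 1 ‖mulVecCLM A‖ (‖mulVecCLM B‖ * feedbackNorm C r K) h * M := by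
  have hk : (0 : ℝ) ≤ k * h := by positivity
  have hM0 : 0 ≤ M := (norm_nonneg _).trans (hM _ hk le_rfl)
  have hBF := mul_nonneg (norm_nonneg (mulVecCLM B)) (feedbackNorm_nonneg C r K)
  have hgronwall := norm_le_gronwallBound_of_norm_deriv_right_le (f := extState x) (a := k * h)
    (b := (k + 1) * h) (δ := M * 1) (K := ‖mulVecCLM A‖)
    (ε := M * (‖mulVecCLM B‖ * feedbackNorm C r K)) hx.continuous_extState.continuousOn
    (fun s hs => hx.hasDerivWithinAt_extState hh (hk.trans hs.1))
    (by rw [extState_of_nonneg x hk, mul_one]; exact hM _ hk le_rfl)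
    (fun s hs => by
      have hs0 := hk.trans hs.1
      rw [mul_comm M]
      refine norm_velocity_le hh hs0 hM0 (fun s' hs' hs'k => hM s' hs' ?_) ?_
      · rwa [sampleTime_eq hh hs.1 hs.2] at hs'k
      · rw [extState_of_nonneg x hs0]) t ⟨hkt, htk⟩
  rw [extState_of_nonneg x (hk.trans hkt), gronwallBound_mul, mul_comm] at hgronwall
  refine hgronwall.trans (mul_le_mul_of_nonneg_right ?_ hM0)
  exact gronwallBound_mono zero_le_one hBF (norm_nonneg _) (by linarith)

theorem IsSampledLoop.norm_le_pow (hh : 0 < h) (hx : IsSampledLoop A B C r h q K x) (k : ℕ)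
    {t : ℝ} (ht : 0 ≤ t) (htk : t ≤ k * h) :
    ‖x t‖ ≤ gronwallBound 1 ‖mulVecCLM A‖ (‖mulVecCLM B‖ * feedbackNorm C r K) h ^ k * ‖x 0‖ := by
  set γ := gronwallBound 1 ‖mulVecCLM A‖ (‖mulVecCLM B‖ * feedbackNorm C r K) h
  have hBF := mul_nonneg (norm_nonneg (mulVecCLM B)) (feedbackNorm_nonneg C r K)
  have hγ : 1 ≤ γ := (gronwallBound_x0 1 ‖mulVecCLM A‖ _).symm.le.trans
    (gronwallBound_mono zero_le_one hBF (norm_nonneg _) hh.le)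
  induction k generalizing t with
  | zero =>
    rw [le_antisymm (by simpa using htk) ht, pow_zero, one_mul]
  | succ k ih =>
    rw [pow_succ', mul_assoc]
    rcases le_total t (k * h) with htk' | htk'
    · exact (ih ht htk').trans (le_mul_of_one_le_left (by positivity) hγ)
    · exact hx.norm_le_of_norm_le hh (fun s => ih) htk' (by exact_mod_cast htk)

theorem exists_bound_of_isSampledLoop (A : Matrix (Fin n) (Fin n) ℝ) (B : Matrix (Fin n) (Fin m) ℝ)
    (C : Matrix (Fin l) (Fin n) ℝ) (r : ℕ) (hh : 0 < h) (q : ℕ → ℕ)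
    (K : ℕ → Matrix (Fin m) (Fin l) ℝ) (N : ℕ) :
    ∃ c : ℝ, ∀ x, IsSampledLoop A B C r h q K x → ∀ t, 0 ≤ t → t ≤ N * h →
      ‖extState x t‖ ≤ c * ‖x 0‖ ∧ ‖velocity A B C r h q K x t‖ ≤ c * ‖x 0‖ := by
  set γ := gronwallBound 1 ‖mulVecCLM A‖ (‖mulVecCLM B‖ * feedbackNorm C r K) h ^ N
  refine ⟨max γ (‖mulVecCLM A‖ * γ + ‖mulVecCLM B‖ * feedbackNorm C r K * γ),
    fun x hx t ht htN => ?_⟩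
  have hbound : ∀ s, 0 ≤ s → s ≤ t → ‖x s‖ ≤ γ * ‖x 0‖ := fun s hs hst =>
    hx.norm_le_pow hh N hs (hst.trans htN)
  have hvel := norm_velocity_le (A := A) (B := B) (C := C) (r := r) (q := q) (K := K) hh ht
    ((norm_nonneg _).trans (hbound t ht le_rfl))
    (fun s hs hst => hbound s hs (hst.trans (sampleTime_le hh ht))) (hbound t ht le_rfl)
  rw [← mul_assoc, ← mul_assoc, ← add_mul] at hvel
  rw [extState_of_nonneg x ht]
  exact ⟨(hbound t ht le_rfl).trans (by gcongr; exact le_max_left _ _),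
    hvel.trans (by gcongr; exact le_max_right _ _)⟩

end Transient

end ClosedLoop
section Lyapunov

variable {n m l : ℕ}

theorem dotProduct_transpose_mulVec {ι κ : Type*} [Fintype ι] [Fintype κ] (M : Matrix ι κ ℝ)
    (v : κ → ℝ) (w : ι → ℝ) : v ⬝ᵥ Mᵀ *ᵥ w = (M *ᵥ v) ⬝ᵥ w := by
  rw [Matrix.dotProduct_mulVec, Matrix.vecMul_transpose]

theorem exists_sqrt_form {k : ℕ} {W : Matrix (Fin k) (Fin k) ℝ} (hW : W.PosSemidef) :
    ∃ S : (Fin k → ℝ) →L[ℝ] EuclideanSpace ℝ (Fin k), ∀ v w, inner ℝ (S v) (S w) = v ⬝ᵥ W *ᵥ w := by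
  open scoped MatrixOrder in
  obtain ⟨S, rfl⟩ := CStarAlgebra.nonneg_iff_eq_star_mul_self.mp hW.nonneg
  refine ⟨(EuclideanSpace.equiv (Fin k) ℝ).symm.toContinuousLinearMap ∘L mulVecCLM S, fun v w => ?_⟩
  rw [← Matrix.mulVec_mulVec, Matrix.star_eq_conjTranspose,
    Matrix.conjTranspose_eq_transpose_of_trivial, dotProduct_transpose_mulVec, dotProduct_comm]
  rfl

theorem exists_norm_sq_le_dotProduct_mulVec {P : Matrix (Fin n) (Fin n) ℝ} (hP : P.PosDef) :
    ∃ ν : ℝ, 0 ≤ ν ∧ ∀ v : Fin n → ℝ, ‖WithLp.toLp 2 v‖ ^ 2 ≤ ν * (v ⬝ᵥ P *ᵥ v) := by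
  obtain ⟨S, hS⟩ := exists_sqrt_form hP.posSemidef
  have hinj : Function.Injective S := (injective_iff_map_eq_zero S).2 fun v hv => by
    by_contra hv0
    have hpos := hP.dotProduct_mulVec_pos hv0
    rw [star_trivial, ← hS, hv, inner_zero_left] at hpos
    exact lt_irrefl _ hpos
  obtain ⟨κ, -, hκ⟩ := LinearMap.exists_antilipschitzWith
    (S.toLinearMap ∘ₗ (WithLp.linearEquiv 2 ℝ (Fin n → ℝ)).toLinearMap)
    (LinearMap.ker_eq_bot.2 (hinj.comp (WithLp.linearEquiv 2 ℝ (Fin n → ℝ)).injective))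
  refine ⟨κ ^ 2, by positivity, fun v => ?_⟩
  have hle := (hκ.le_mul_dist (WithLp.toLp 2 v) 0)
  rw [dist_zero_right, map_zero, dist_zero_right] at hle
  rw [← hS, real_inner_self_eq_norm_sq, ← mul_pow]
  exact pow_le_pow_left₀ (norm_nonneg _) hle 2

theorem map_taylorRem {G : Type*} [NormedAddCommGroup G] [NormedSpace ℝ G] [NormedSpace ℝ F]
    (L : F →L[ℝ] G) (r : ℕ) (f : ℕ → ℝ → F) (η s : ℝ) :
    L (taylorRem r f η s) = taylorRem r (fun j t => L (f j t)) η s := by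
  simp only [taylorRem, map_sub, map_sum, map_smul]

/-- The dissipation inequality behind the Lyapunov argument: `v` stands for the state, `y` for its
velocity, and `d`, `e` for the sampling and the delay errors. -/
def Dissipation (A : Matrix (Fin n) (Fin n) ℝ) (B : Matrix (Fin n) (Fin m) ℝ)
    (C : Matrix (Fin l) (Fin n) ℝ) (r : ℕ) (h : ℝ) (q : ℕ → ℕ)
    (K : ℕ → Matrix (Fin m) (Fin l) ℝ) (α : ℝ) (P : Matrix (Fin n) (Fin n) ℝ)
    (W R : ℕ → Matrix (Fin m) (Fin m) ℝ) : Prop :=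
  ∀ (v y : Fin n → ℝ) (d e : ℕ → Fin m → ℝ),
    y = matD A B C r h q K *ᵥ v + B *ᵥ ∑ i ∈ Finset.range r, d i +
      B *ᵥ ∑ i ∈ Finset.range (r - 1), e (i + 1) →
    2 * (v ⬝ᵥ P *ᵥ y) + 2 * α * (v ⬝ᵥ P *ᵥ v) +
      ∑ i ∈ Finset.range r, h ^ 2 * Real.exp (2 * α * h) *
        (K i *ᵥ ((C * A) *ᵥ v) ⬝ᵥ W i *ᵥ (K i *ᵥ ((C * A) *ᵥ v))) +
      ∑ i ∈ Finset.range (r - 1), (q (i + 1) * h) ^ r *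
        (K (i + 1) *ᵥ ((C * A ^ (r - 1)) *ᵥ y) ⬝ᵥ
          R (i + 1) *ᵥ (K (i + 1) *ᵥ ((C * A ^ (r - 1)) *ᵥ y))) ≤
    ∑ i ∈ Finset.range r, Real.pi ^ 2 / 4 * Real.exp (-2 * α * (q i * h)) *
        (d i ⬝ᵥ W i *ᵥ d i) +
      ∑ i ∈ Finset.range (r - 1), (r ! : ℝ) ^ 2 / (q (i + 1) * h) ^ r *
        Real.exp (-2 * α * (q (i + 1) * h)) * (e (i + 1) ⬝ᵥ R (i + 1) *ᵥ e (i + 1))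

variable {A : Matrix (Fin n) (Fin n) ℝ} {B : Matrix (Fin n) (Fin m) ℝ}
  {C : Matrix (Fin l) (Fin n) ℝ} {r : ℕ} {h : ℝ} {q : ℕ → ℕ}
  {K : ℕ → Matrix (Fin m) (Fin l) ℝ} {x : ℝ → Fin n → ℝ} {α : ℝ} {N : ℕ}

theorem IsSampledLoop.hasDerivWithinAt_outputDeriv (hCB : ∀ i, i + 2 ≤ r → C * A ^ i * B = 0)
    (hh : 0 < h) (hx : IsSampledLoop A B C r h q K x) {j : ℕ} (hj : j < r) {t : ℝ} (ht : 0 ≤ t) :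
    HasDerivWithinAt (outputDeriv A B C r h q K x j) (outputDeriv A B C r h q K x (j + 1) t)
      (Ici t) t := by
  rw [outputDeriv_of_lt hCB hj]
  exact (mulVecCLM (C * A ^ j)).hasFDerivAt.comp_hasDerivWithinAt t
    (hx.hasDerivWithinAt_extState hh ht)

theorem IsSampledLoop.continuous_outputDeriv (hCB : ∀ i, i + 2 ≤ r → C * A ^ i * B = 0)
    (hx : IsSampledLoop A B C r h q K x) {j : ℕ} (hj : j < r) :
    Continuous (outputDeriv A B C r h q K x j) := by
  rw [outputDeriv_of_lt hCB hj]
  exact (mulVecCLM (C * A ^ j)).continuous.comp hx.continuous_extState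

theorem outputDeriv_one (hCB : ∀ i, i + 2 ≤ r → C * A ^ i * B = 0) (hr : 2 ≤ r) :
    outputDeriv A B C r h q K x 1 = fun t => (C * A) *ᵥ extState x t := by
  rw [outputDeriv_of_lt hCB hr, pow_one]

theorem isLocBdd_outputDeriv (hh : 0 < h) (hx : Continuous (extState x)) (j : ℕ) :
    IsLocBdd (outputDeriv A B C r h q K x j) := by
  cases j with
  | zero => exact .of_continuous ((mulVecCLM C).continuous.comp hx)
  | succ j =>
    exact .clm_apply (L := fun _ => mulVecCLM (C * A ^ j)) continuous_const
      (isLocBdd_velocity hh hx)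

theorem integral_exp_mul_norm_sq_le {g : ℝ → F} {a T M : ℝ} (hα : 0 ≤ α) (haT : a ≤ T)
    (hg : ∀ s, a ≤ s → s ≤ T → ‖g s‖ ≤ M) :
    ∫ s in a..T, Real.exp (2 * α * s) * ‖g s‖ ^ 2 ≤ Real.exp (2 * α * T) * M ^ 2 * (T - a) := by
  rw [← abs_of_nonneg (sub_nonneg.2 haT)]
  refine (Real.le_norm_self _).trans (norm_integral_le_of_norm_le_const fun s hs => ?_)
  rw [uIoc_of_le haT] at hs
  rw [Real.norm_of_nonneg (by positivity)]
  have hgs := hg s hs.1.le hs.2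
  gcongr
  exact hs.2

theorem exists_bound_outputDeriv (A : Matrix (Fin n) (Fin n) ℝ) (B : Matrix (Fin n) (Fin m) ℝ)
    (C : Matrix (Fin l) (Fin n) ℝ) (r : ℕ) (hh : 0 < h) (q : ℕ → ℕ)
    (K : ℕ → Matrix (Fin m) (Fin l) ℝ) (N : ℕ) (j : ℕ) :
    ∃ c : ℝ, ∀ x, IsSampledLoop A B C r h q K x → ∀ t, 0 ≤ t → t ≤ N * h →
      ‖outputDeriv A B C r h q K x j t‖ ≤ c * ‖x 0‖ := by
  obtain ⟨c, hc⟩ := exists_bound_of_isSampledLoop A B C r hh q K N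
  cases j with
  | zero =>
    refine ⟨‖mulVecCLM C‖ * c, fun x hx t ht htN => (norm_mulVec_le _ _).trans ?_⟩
    rw [mul_assoc]
    gcongr
    exact (hc x hx t ht htN).1
  | succ j =>
    refine ⟨‖mulVecCLM (C * A ^ j)‖ * c, fun x hx t ht htN => (norm_mulVec_le _ _).trans ?_⟩
    rw [mul_assoc]
    gcongr
    exact (hc x hx t ht htN).2

theorem exists_integral_outputDeriv_le {p j : ℕ} (A : Matrix (Fin n) (Fin n) ℝ)
    (B : Matrix (Fin n) (Fin m) ℝ) (C : Matrix (Fin l) (Fin n) ℝ) (r : ℕ) (hh : 0 < h) (q : ℕ → ℕ)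
    (K : ℕ → Matrix (Fin m) (Fin l) ℝ) (hα : 0 ≤ α) (hp : p ≤ N) (L : (Fin l → ℝ) →L[ℝ] E) :
    ∃ c : ℝ, ∀ x, IsSampledLoop A B C r h q K x →
      ∫ s in (N * h - p * h)..(N * h), Real.exp (2 * α * s) *
        ‖L (outputDeriv A B C r h q K x j s)‖ ^ 2 ≤ c * ‖x 0‖ ^ 2 := by
  obtain ⟨c, hc⟩ := exists_bound_outputDeriv A B C r hh q K N j
  have hpN : (p : ℝ) * h ≤ N * h := by gcongr
  refine ⟨Real.exp (2 * α * (N * h)) * (‖L‖ * c) ^ 2 * (p * h), fun x hx => ?_⟩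
  refine (integral_exp_mul_norm_sq_le (M := ‖L‖ * (c * ‖x 0‖)) hα
    (sub_le_self _ (by positivity)) fun s hs hsT => ?_).trans_eq (by ring)
  exact L.le_opNorm_of_le (hc x hx s ((sub_nonneg.2 hpN).trans hs) hsT)

theorem exists_integral_samplingSupply_le {p : ℕ} (hr : 2 ≤ r)
    (hCB : ∀ i, i + 2 ≤ r → C * A ^ i * B = 0) (hh : 0 < h) (q : ℕ → ℕ)
    (K : ℕ → Matrix (Fin m) (Fin l) ℝ) (hα : 0 ≤ α) (hp : p ≤ N) (L : (Fin l → ℝ) →L[ℝ] E) :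
    ∃ c : ℝ, ∀ x, IsSampledLoop A B C r h q K x → ∀ t, N * h ≤ t →
      ∫ s in (N * h)..t, samplingSupply α h p (fun s => L (outputDeriv A B C r h q K x 0 s))
        (fun s => L (outputDeriv A B C r h q K x 1 s)) s ≤ c * ‖x 0‖ ^ 2 := by
  obtain ⟨c, hc⟩ := exists_integral_outputDeriv_le (j := 1) A B C r hh q K hα hp L
  refine ⟨h ^ 2 * Real.exp (2 * α * h) * c, fun x hx t ht => ?_⟩
  refine (integral_samplingSupply_le hh hα (L.continuous.comp
    (hx.continuous_outputDeriv hCB (by omega))) (L.continuous.comp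
    (hx.continuous_outputDeriv hCB (by omega))) (fun s hs =>
      L.hasFDerivAt.comp_hasDerivWithinAt s (hx.hasDerivWithinAt_outputDeriv hCB hh (by omega) hs))
    hp ht).trans ?_
  rw [mul_assoc _ c]
  gcongr
  exact hc x hx

theorem exists_integral_delaySupply_le [CompleteSpace E] {p : ℕ} (hr : 0 < r)
    (hCB : ∀ i, i + 2 ≤ r → C * A ^ i * B = 0) (hh : 0 < h) (q : ℕ → ℕ)
    (K : ℕ → Matrix (Fin m) (Fin l) ℝ) (hα : 0 ≤ α) (hp0 : 0 < p) (hp : p ≤ N)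
    (L : (Fin l → ℝ) →L[ℝ] E) :
    ∃ c : ℝ, ∀ x, IsSampledLoop A B C r h q K x → ∀ t, N * h ≤ t →
      ∫ s in (N * h)..t, delaySupply α (p * h) r
        (fun j s => L (outputDeriv A B C r h q K x j s)) s ≤ c * ‖x 0‖ ^ 2 := by
  obtain ⟨k, rfl⟩ := Nat.exists_eq_succ_of_ne_zero hr.ne'
  obtain ⟨c, hc⟩ := exists_integral_outputDeriv_le (j := k + 1) A B C (k + 1) hh q K hα hp L
  refine ⟨(p * h) ^ (k + 1) * c, fun x hx t ht => ?_⟩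
  refine (integral_delaySupply_le (by positivity) hα
    (fun j hj => L.continuous.comp (hx.continuous_outputDeriv hCB (Nat.lt_succ_of_le hj)))
    (fun j hj s hs => L.hasFDerivAt.comp_hasDerivWithinAt s
      (hx.hasDerivWithinAt_outputDeriv hCB hh (Nat.lt_succ_of_le hj) hs))
    (.clm_apply continuous_const (isLocBdd_outputDeriv hh hx.continuous_extState _))
    (mul_le_mul_of_nonneg_right (Nat.cast_le.2 hp) hh.le) ht).trans ?_
  rw [mul_assoc _ c]
  gcongr
  exact hc x hx

/-- The total supply along a closed-loop trajectory: the sampling and the delay supplies of the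
measurements `Lw i y` and `Lr i y`. -/
def supply (A : Matrix (Fin n) (Fin n) ℝ) (B : Matrix (Fin n) (Fin m) ℝ)
    (C : Matrix (Fin l) (Fin n) ℝ) (r : ℕ) (h : ℝ) (q : ℕ → ℕ)
    (K : ℕ → Matrix (Fin m) (Fin l) ℝ) (α : ℝ) (Lw Lr : ℕ → (Fin l → ℝ) →L[ℝ] E)
    (x : ℝ → Fin n → ℝ) (s : ℝ) : ℝ :=
  ∑ i ∈ Finset.range r, samplingSupply α h (q i)
      (fun s => Lw i (outputDeriv A B C r h q K x 0 s))
      (fun s => Lw i (outputDeriv A B C r h q K x 1 s)) s +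
    ∑ i ∈ Finset.range (r - 1), delaySupply α (q (i + 1) * h) r
      (fun j s => Lr (i + 1) (outputDeriv A B C r h q K x j s)) s

theorem IsSampledLoop.isLocBdd_samplingSupply (hr : 2 ≤ r)
    (hCB : ∀ i, i + 2 ≤ r → C * A ^ i * B = 0) (hh : 0 < h)
    (hx : IsSampledLoop A B C r h q K x) (L : (Fin l → ℝ) →L[ℝ] E) (p : ℕ) :
    IsLocBdd (samplingSupply α h p (fun s => L (outputDeriv A B C r h q K x 0 s))
      (fun s => L (outputDeriv A B C r h q K x 1 s))) :=
  SampledData.isLocBdd_samplingSupply hh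
    (L.continuous.comp (hx.continuous_outputDeriv hCB (by omega)))
    (L.continuous.comp (hx.continuous_outputDeriv hCB (by omega))) p

theorem IsSampledLoop.isLocBdd_delaySupply (hr : 0 < r)
    (hCB : ∀ i, i + 2 ≤ r → C * A ^ i * B = 0) (hh : 0 < h)
    (hx : IsSampledLoop A B C r h q K x) (L : (Fin l → ℝ) →L[ℝ] E) (η : ℝ) :
    IsLocBdd (delaySupply α η r fun j s => L (outputDeriv A B C r h q K x j s)) :=
  SampledData.isLocBdd_delaySupply hr
    (fun _ hj => L.continuous.comp (hx.continuous_outputDeriv hCB hj))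
    (.clm_apply continuous_const (isLocBdd_outputDeriv hh hx.continuous_extState _))

theorem IsSampledLoop.isLocBdd_supply (hr : 2 ≤ r) (hCB : ∀ i, i + 2 ≤ r → C * A ^ i * B = 0)
    (hh : 0 < h) (hx : IsSampledLoop A B C r h q K x) (Lw Lr : ℕ → (Fin l → ℝ) →L[ℝ] E) :
    IsLocBdd (supply A B C r h q K α Lw Lr x) :=
  .add (.sum _ fun _ _ => hx.isLocBdd_samplingSupply hr hCB hh _ _)
    (.sum _ fun _ _ => hx.isLocBdd_delaySupply (by omega) hCB hh _ _)

theorem exists_integral_supply_le [CompleteSpace E] (hr : 2 ≤ r)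
    (hCB : ∀ i, i + 2 ≤ r → C * A ^ i * B = 0) (hh : 0 < h) (hqN : ∀ i < r, q i ≤ N)
    (hq0 : ∀ i < r - 1, 0 < q (i + 1)) (K : ℕ → Matrix (Fin m) (Fin l) ℝ) (hα : 0 ≤ α)
    (Lw Lr : ℕ → (Fin l → ℝ) →L[ℝ] E) :
    ∃ c : ℝ, ∀ x, IsSampledLoop A B C r h q K x → ∀ t, N * h ≤ t →
      ∫ s in (N * h)..t, supply A B C r h q K α Lw Lr x s ≤ c * ‖x 0‖ ^ 2 := by
  choose! cw hcw using fun i (hi : i ∈ Finset.range r) =>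
    exists_integral_samplingSupply_le (A := A) (B := B) hr hCB hh q K hα
      (hqN i (Finset.mem_range.1 hi)) (Lw i)
  choose! cr hcr using fun i (hi : i ∈ Finset.range (r - 1)) =>
    exists_integral_delaySupply_le (A := A) (B := B) (by omega) hCB hh q K hα
      (hq0 i (Finset.mem_range.1 hi)) (hqN (i + 1) (Nat.add_lt_of_lt_sub (Finset.mem_range.1 hi)))
      (Lr (i + 1))
  refine ⟨∑ i ∈ Finset.range r, cw i + ∑ i ∈ Finset.range (r - 1), cr i, fun x hx t ht => ?_⟩
  have hbw : ∀ i ∈ Finset.range r, IsLocBdd _ := fun i _ =>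
    hx.isLocBdd_samplingSupply (α := α) hr hCB hh (Lw i) (q i)
  have hbr : ∀ i ∈ Finset.range (r - 1), IsLocBdd _ := fun i _ =>
    hx.isLocBdd_delaySupply (α := α) (by omega) hCB hh (Lr (i + 1)) (q (i + 1) * h)
  simp only [supply]
  rw [intervalIntegral.integral_add ((IsLocBdd.sum _ hbw).intervalIntegrable _ _)
      ((IsLocBdd.sum _ hbr).intervalIntegrable _ _),
    integral_finsetSum fun i hi => (hbw i hi).intervalIntegrable _ _,
    integral_finsetSum fun i hi => (hbr i hi).intervalIntegrable _ _, add_mul, Finset.sum_mul,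
    Finset.sum_mul]
  exact add_le_add (Finset.sum_le_sum fun i hi => hcw i hi x hx t ht)
    (Finset.sum_le_sum fun i hi => hcr i hi x hx t ht)

theorem exp_two_mul_sub (α s η : ℝ) :
    Real.exp (2 * α * (s - η)) = Real.exp (2 * α * s) * Real.exp (-2 * α * η) := by
  rw [← Real.exp_add]
  ring_nf

theorem samplingSupply_outputDeriv (hr : 2 ≤ r) (hCB : ∀ i, i + 2 ≤ r → C * A ^ i * B = 0)
    {W : Matrix (Fin m) (Fin m) ℝ} {S : (Fin m → ℝ) →L[ℝ] E}
    (hS : ∀ v w, inner ℝ (S v) (S w) = v ⬝ᵥ W *ᵥ w) (i : ℕ) (s : ℝ) :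
    samplingSupply α h (q i)
        (fun s => (S ∘L mulVecCLM (K i)) (outputDeriv A B C r h q K x 0 s))
        (fun s => (S ∘L mulVecCLM (K i)) (outputDeriv A B C r h q K x 1 s)) s =
      Real.exp (2 * α * s) * (Real.pi ^ 2 / 4 * Real.exp (-2 * α * (q i * h)) *
          (samplingError C h q K x i s ⬝ᵥ W *ᵥ samplingError C h q K x i s) -
        h ^ 2 * Real.exp (2 * α * h) * (K i *ᵥ ((C * A) *ᵥ extState x s) ⬝ᵥ
          W *ᵥ (K i *ᵥ ((C * A) *ᵥ extState x s)))) := by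
  have herror : ‖(S ∘L mulVecCLM (K i)) (outputDeriv A B C r h q K x 0 (s - q i * h)) -
      (S ∘L mulVecCLM (K i)) (outputDeriv A B C r h q K x 0 (sampleTime h s - q i * h))‖ ^ 2 =
      samplingError C h q K x i s ⬝ᵥ W *ᵥ samplingError C h q K x i s := by
    rw [norm_sub_rev, ← map_sub, ← real_inner_self_eq_norm_sq]
    exact hS _ _
  rw [samplingSupply, herror, outputDeriv_one hCB hr, exp_two_mul_sub,
    ← real_inner_self_eq_norm_sq, ContinuousLinearMap.comp_apply, hS]
  simp only [mulVecCLM_apply]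
  ring

theorem delaySupply_outputDeriv (hr : 0 < r) (hCB : ∀ i, i + 2 ≤ r → C * A ^ i * B = 0)
    {R : Matrix (Fin m) (Fin m) ℝ} {S : (Fin m → ℝ) →L[ℝ] E}
    (hS : ∀ v w, inner ℝ (S v) (S w) = v ⬝ᵥ R *ᵥ w) (i : ℕ) (s : ℝ) :
    delaySupply α (q i * h) r
        (fun j s => (S ∘L mulVecCLM (K i)) (outputDeriv A B C r h q K x j s)) s =
      Real.exp (2 * α * s) * ((r ! : ℝ) ^ 2 / (q i * h) ^ r * Real.exp (-2 * α * (q i * h)) *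
          (delayError A C r h q K x i s ⬝ᵥ R *ᵥ delayError A C r h q K x i s) -
        (q i * h) ^ r * (K i *ᵥ ((C * A ^ (r - 1)) *ᵥ velocity A B C r h q K x s) ⬝ᵥ
          R *ᵥ (K i *ᵥ ((C * A ^ (r - 1)) *ᵥ velocity A B C r h q K x s)))) := by
  obtain ⟨k, rfl⟩ := Nat.exists_eq_succ_of_ne_zero hr.ne'
  have herror : (S ∘L mulVecCLM (K i)) (taylorRem (k + 1) (outputDeriv A B C (k + 1) h q K x)
      (q i * h) s) = S (delayError A C (k + 1) h q K x i s) := by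
    simp only [delayError, taylorRem]
    rw [outputDeriv_of_lt hCB k.succ_pos, Finset.sum_congr rfl fun j hj => by
      rw [outputDeriv_of_lt hCB (Finset.mem_range.1 hj)]]
    rfl
  rw [delaySupply, ← map_taylorRem, herror, exp_two_mul_sub, ← real_inner_self_eq_norm_sq, hS,
    ← real_inner_self_eq_norm_sq, ContinuousLinearMap.comp_apply, hS]
  simp only [mulVecCLM_apply, outputDeriv, Nat.succ_eq_add_one, Nat.add_sub_cancel]
  ring

theorem Dissipation.rate_le_supply {P : Matrix (Fin n) (Fin n) ℝ}
    {W R : ℕ → Matrix (Fin m) (Fin m) ℝ} (hdis : Dissipation A B C r h q K α P W R) (hr : 2 ≤ r)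
    (hCB : ∀ i, i + 2 ≤ r → C * A ^ i * B = 0) (hh : 0 < h) (hq0 : q 0 = 0)
    (hqN : ∀ i < r, q i ≤ N) {Sw Sr : ℕ → (Fin m → ℝ) →L[ℝ] E}
    (hSw : ∀ i < r, ∀ v w, inner ℝ (Sw i v) (Sw i w) = v ⬝ᵥ W i *ᵥ w)
    (hSr : ∀ i, 1 ≤ i → i < r → ∀ v w, inner ℝ (Sr i v) (Sr i w) = v ⬝ᵥ R i *ᵥ w) {s : ℝ}
    (hs : N * h ≤ s) :
    Real.exp (2 * α * s) * (2 * (extState x s ⬝ᵥ P *ᵥ velocity A B C r h q K x s) +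
        2 * α * (extState x s ⬝ᵥ P *ᵥ extState x s)) ≤
      supply A B C r h q K α (fun i => Sw i ∘L mulVecCLM (K i))
        (fun i => Sr i ∘L mulVecCLM (K i)) x s := by
  have hrate := hdis _ _ (fun i => samplingError C h q K x i s)
    (fun i => delayError A C r h q K x i s) (velocity_eq (x := x) (by omega) hh hq0 hqN hs)
  have hw : ∀ i ∈ Finset.range r, _ := fun i hi => samplingSupply_outputDeriv (α := α) (h := h)
    (q := q) (x := x) (K := K) hr hCB (hSw i (Finset.mem_range.1 hi)) i s
  have hd : ∀ i ∈ Finset.range (r - 1), _ := fun i hi =>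
    delaySupply_outputDeriv (α := α) (h := h) (q := q) (x := x) (K := K) (by omega) hCB
      (hSr (i + 1) (by omega) (Nat.add_lt_of_lt_sub (Finset.mem_range.1 hi))) (i + 1) s
  rw [supply, Finset.sum_congr rfl hw, Finset.sum_congr rfl hd, ← Finset.mul_sum,
    ← Finset.mul_sum, ← mul_add, Finset.sum_sub_distrib, Finset.sum_sub_distrib]
  refine mul_le_mul_of_nonneg_left ?_ (Real.exp_nonneg _)
  linarith

theorem Dissipation.exists_energy_bound {P : Matrix (Fin n) (Fin n) ℝ}
    {W R : ℕ → Matrix (Fin m) (Fin m) ℝ} (hdis : Dissipation A B C r h q K α P W R) (hr : 2 ≤ r)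
    (hCB : ∀ i, i + 2 ≤ r → C * A ^ i * B = 0) (hh : 0 < h) (hq0 : q 0 = 0)
    (hqN : ∀ i < r, q i ≤ N) (hqpos : ∀ i < r - 1, 0 < q (i + 1)) (hα : 0 ≤ α)
    (hP : P.PosSemidef) (hW : ∀ i < r, (W i).PosSemidef)
    (hR : ∀ i, 1 ≤ i → i < r → (R i).PosSemidef) :
    ∃ c : ℝ, ∀ x, IsSampledLoop A B C r h q K x → ∀ t, N * h ≤ t →
      Real.exp (2 * α * t) * (x t ⬝ᵥ P *ᵥ x t) ≤ c * ‖x 0‖ ^ 2 := by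
  obtain ⟨S, hS⟩ := exists_sqrt_form hP
  choose! Sw hSw using fun i hi => exists_sqrt_form (hW i hi)
  choose! Sr hSr using fun i hi hir => exists_sqrt_form (hR i hi hir)
  obtain ⟨c₁, hc₁⟩ := exists_bound_of_isSampledLoop A B C r hh q K N
  obtain ⟨c₂, hc₂⟩ := exists_integral_supply_le (A := A) (B := B) hr hCB hh hqN hqpos K hα
    (fun i => Sw i ∘L mulVecCLM (K i)) (fun i => Sr i ∘L mulVecCLM (K i))
  refine ⟨Real.exp (2 * α * (N * h)) * (‖S‖ * c₁) ^ 2 + c₂, fun x hx t ht => ?_⟩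
  have hT : (0 : ℝ) ≤ N * h := by positivity
  set X := extState x
  set V : ℝ → ℝ := fun s => Real.exp (2 * α * s) * ‖S (X s)‖ ^ 2
  have hderiv : ∀ s, 0 ≤ s → HasDerivWithinAt V (Real.exp (2 * α * s) *
      (2 * (X s ⬝ᵥ P *ᵥ velocity A B C r h q K x s) + 2 * α * (X s ⬝ᵥ P *ᵥ X s))) (Ici s) s :=
    fun s hs => by
      have hexp := ((hasDerivAt_id s).const_mul (2 * α)).exp.hasDerivWithinAt (s := Ici s)
      refine (hexp.mul (S.hasFDerivAt.comp_hasDerivWithinAt s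
        (hx.hasDerivWithinAt_extState hh hs)).norm_sq).congr_deriv ?_
      simp only [X, Function.comp_apply, hS, ← real_inner_self_eq_norm_sq, id]
      ring
  have hcont : Continuous V := by
    have := hx.continuous_extState
    fun_prop
  have henergy : V t - V (N * h) ≤ c₂ * ‖x 0‖ ^ 2 :=
    (sub_le_integral_of_hasDeriv_right_of_le ht hcont.continuousOn
      (fun s hs => (hderiv s (hT.trans hs.1.le)).mono Ioi_subset_Ici_self)
      ((intervalIntegrable_iff_integrableOn_Icc_of_le ht).1
        ((hx.isLocBdd_supply hr hCB hh _ _).intervalIntegrable _ _))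
      (fun s hs => hdis.rate_le_supply hr hCB hh hq0 hqN hSw hSr hs.1.le)).trans (hc₂ x hx t ht)
  have hinit : V (N * h) ≤ Real.exp (2 * α * (N * h)) * (‖S‖ * (c₁ * ‖x 0‖)) ^ 2 :=
    mul_le_mul_of_nonneg_left (pow_le_pow_left₀ (norm_nonneg _)
      (S.le_opNorm_of_le (hc₁ x hx _ hT le_rfl).1) 2) (Real.exp_nonneg _)
  rw [← extState_of_nonneg x (hT.trans ht), ← hS, real_inner_self_eq_norm_sq]
  linarith

theorem strictMonoOn_Iio_of_lt_succ {q : ℕ → ℕ} (hq : ∀ i, i + 1 < r → q i < q (i + 1)) :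
    StrictMonoOn q (Iio r) :=
  strictMonoOn_of_lt_succ ordConnected_Iio fun i _ _ hi => hq i hi

theorem norm_le_norm_toLp (v : Fin n → ℝ) : ‖v‖ ≤ ‖WithLp.toLp 2 v‖ :=
  (pi_norm_le_iff_of_nonneg (norm_nonneg _)).2 (PiLp.norm_apply_le (WithLp.toLp 2 v))

theorem exists_norm_toLp_le (n : ℕ) :
    ∃ κ : ℝ, 0 ≤ κ ∧ ∀ v : Fin n → ℝ, ‖WithLp.toLp 2 v‖ ≤ κ * ‖v‖ :=
  ⟨_, norm_nonneg _, (EuclideanSpace.equiv (Fin n) ℝ).symm.toContinuousLinearMap.le_opNorm⟩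

theorem isExpStable_of_norm_le {Loop : (ℝ → Fin n → ℝ) → Prop}
    (hex : ∀ x₀ : Fin n → ℝ, ∃ x, Loop x ∧ x 0 = x₀) {T c₁ c₂ : ℝ}
    (h₁ : ∀ x, Loop x → ∀ t, 0 ≤ t → t ≤ T → ‖x t‖ ≤ c₁ * ‖x 0‖)
    (h₂ : ∀ x, Loop x → ∀ t, T ≤ t → ‖WithLp.toLp 2 (x t)‖ ≤ c₂ * Real.exp (-α * t) * ‖x 0‖)
    (hα : 0 ≤ α) : IsExpStable Loop α := by
  obtain ⟨κ, hκ, hnorm⟩ := exists_norm_toLp_le n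
  refine ⟨hex, Real.exp (α * T) * (κ * |c₁|) + |c₂|, fun x hx t ht => ?_⟩
  rcases le_total t T with htT | htT
  · have hexp : 1 ≤ Real.exp (α * T) * Real.exp (-α * t) := by
      rw [← Real.exp_add]
      exact Real.one_le_exp (by nlinarith)
    calc ‖WithLp.toLp 2 (x t)‖ ≤ κ * (|c₁| * ‖x 0‖) := (hnorm _).trans (by
          gcongr
          exact (h₁ x hx t ht htT).trans (by gcongr; exact le_abs_self c₁))
      _ ≤ Real.exp (α * T) * Real.exp (-α * t) * (κ * (|c₁| * ‖x 0‖)) :=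
        le_mul_of_one_le_left (by positivity) hexp
      _ = Real.exp (α * T) * (κ * |c₁|) * Real.exp (-α * t) * ‖x 0‖ := by ring
      _ ≤ _ := by
        gcongr
        · exact le_add_of_nonneg_right (abs_nonneg _)
        · exact norm_le_norm_toLp _
  · refine (h₂ x hx t htT).trans ?_
    gcongr
    · exact (le_abs_self _).trans (le_add_of_nonneg_left (by positivity))
    · exact norm_le_norm_toLp _

theorem norm_toLp_le_of_energy_le {P : Matrix (Fin n) (Fin n) ℝ} {ν c a t : ℝ} (hν : 0 ≤ ν)
    (ha : 0 ≤ a) {v : Fin n → ℝ} (hvP : ‖WithLp.toLp 2 v‖ ^ 2 ≤ ν * (v ⬝ᵥ P *ᵥ v))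
    (hv : Real.exp (2 * α * t) * (v ⬝ᵥ P *ᵥ v) ≤ c * a ^ 2) :
    ‖WithLp.toLp 2 v‖ ≤ √(ν * |c|) * Real.exp (-α * t) * a := by
  refine le_of_sq_le_sq ?_ (by positivity)
  have hexp : Real.exp (-α * t) ^ 2 * Real.exp (2 * α * t) = 1 := by
    rw [← Real.exp_nat_mul, ← Real.exp_add, Real.exp_eq_one_iff]
    push_cast
    ring
  have hv' := hv.trans (mul_le_mul_of_nonneg_right (le_abs_self c) (sq_nonneg a))
  calc ‖WithLp.toLp 2 v‖ ^ 2 ≤ ν * (v ⬝ᵥ P *ᵥ v) := hvP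
    _ = ν * (Real.exp (-α * t) ^ 2 * (Real.exp (2 * α * t) * (v ⬝ᵥ P *ᵥ v))) := by
      rw [← mul_assoc (_ ^ 2), hexp, one_mul]
    _ ≤ ν * (Real.exp (-α * t) ^ 2 * (|c| * a ^ 2)) := by gcongr
    _ = (√(ν * |c|) * Real.exp (-α * t) * a) ^ 2 := by
      rw [mul_pow, mul_pow, Real.sq_sqrt (by positivity)]
      ring

theorem Dissipation.isExpStable {P : Matrix (Fin n) (Fin n) ℝ}
    {W R : ℕ → Matrix (Fin m) (Fin m) ℝ} (hdis : Dissipation A B C r h q K α P W R) (hr : 2 ≤ r)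
    (hCB : ∀ i, i + 2 ≤ r → C * A ^ i * B = 0) (hh : 0 < h) (hq0 : q 0 = 0)
    (hq : ∀ i, i + 1 < r → q i < q (i + 1)) (hα : 0 ≤ α) (hP : P.PosDef)
    (hW : ∀ i < r, (W i).PosSemidef) (hR : ∀ i, 1 ≤ i → i < r → (R i).PosSemidef) :
    IsExpStable (IsSampledLoop A B C r h q K) α := by
  have hmono := (strictMonoOn_Iio_of_lt_succ hq).monotoneOn
  have hqN : ∀ i < r, q i ≤ q (r - 1) := fun i hi =>
    hmono hi (mem_Iio.2 (by omega)) (Nat.le_sub_one_of_lt hi)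
  have hqpos : ∀ i < r - 1, 0 < q (i + 1) := fun i hi => pos_of_gt (hq i (by omega))
  obtain ⟨c₁, hc₁⟩ := exists_bound_of_isSampledLoop A B C r hh q K (q (r - 1))
  obtain ⟨c₂, hc₂⟩ :=
    hdis.exists_energy_bound hr hCB hh hq0 hqN hqpos hα hP.posSemidef hW hR
  obtain ⟨ν, hν, hνP⟩ := exists_norm_sq_le_dotProduct_mulVec hP
  refine isExpStable_of_norm_le (c₁ := c₁) (exists_isSampledLoop A B C r hh q K)
    (fun x hx t ht htN => ?_)
    (fun x hx t ht => norm_toLp_le_of_energy_le hν (norm_nonneg _) (hνP _) (hc₂ x hx t ht)) hα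
  rw [← extState_of_nonneg x ht]
  exact (hc₁ x hx t ht htN).1

end Lyapunov

section MatrixInequality

variable {n m l : ℕ} {A : Matrix (Fin n) (Fin n) ℝ} {B : Matrix (Fin n) (Fin m) ℝ}
  {C : Matrix (Fin l) (Fin n) ℝ} {r : ℕ} {h : ℝ} {q : ℕ → ℕ}
  {K : ℕ → Matrix (Fin m) (Fin l) ℝ} {α : ℝ}

theorem dotProduct_fromBlocks_mulVec_self {ι κ : Type*} [Fintype ι] [Fintype κ]
    (M : Matrix ι ι ℝ) (N : Matrix ι κ ℝ) (Q : Matrix κ κ ℝ) (v : ι → ℝ) (w : κ → ℝ) :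
    Sum.elim v w ⬝ᵥ Matrix.fromBlocks M N Nᵀ Q *ᵥ Sum.elim v w =
      v ⬝ᵥ M *ᵥ v + 2 * (v ⬝ᵥ N *ᵥ w) + w ⬝ᵥ Q *ᵥ w := by
  rw [Matrix.fromBlocks_mulVec, sumElim_dotProduct_sumElim, Sum.elim_comp_inl,
    Sum.elim_comp_inr, dotProduct_add, dotProduct_add, dotProduct_transpose_mulVec,
    dotProduct_comm (N *ᵥ w)]
  ring

theorem repeatRow_mulVec {a b s : ℕ} (X : Matrix (Fin a) (Fin b) ℝ) (w : ℕ → Fin b → ℝ) :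
    repeatRow s X *ᵥ (fun p : Fin b × Fin s => w p.2 p.1) =
      X *ᵥ ∑ i ∈ Finset.range s, w i := by
  rw [← Fin.sum_univ_eq_sum_range]
  funext c
  simp only [Matrix.mulVec, dotProduct, repeatRow, Matrix.submatrix_apply, id,
    Fintype.sum_prod_type, Finset.sum_apply, Finset.mul_sum]

theorem dotProduct_repeatCol_mulVec {a b s : ℕ} (X : Matrix (Fin a) (Fin b) ℝ)
    (w : ℕ → Fin a → ℝ) (z : Fin b → ℝ) :
    (fun p : Fin a × Fin s => w p.2 p.1) ⬝ᵥ repeatCol s X *ᵥ z =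
      (∑ i ∈ Finset.range s, w i) ⬝ᵥ X *ᵥ z := by
  rw [show repeatCol s X = (repeatRow s Xᵀ)ᵀ from rfl, dotProduct_transpose_mulVec,
    repeatRow_mulVec, ← dotProduct_transpose_mulVec, Matrix.transpose_transpose]

theorem dotProduct_blockDiagonal_mulVec {s : ℕ} (W : ℕ → Matrix (Fin m) (Fin m) ℝ)
    (w : ℕ → Fin m → ℝ) :
    (fun p : Fin m × Fin s => w p.2 p.1) ⬝ᵥ (Matrix.blockDiagonal fun i : Fin s => W i) *ᵥ
      (fun p : Fin m × Fin s => w p.2 p.1) = ∑ i ∈ Finset.range s, w i ⬝ᵥ W i *ᵥ w i := by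
  rw [← Fin.sum_univ_eq_sum_range (fun i => w i ⬝ᵥ W i *ᵥ w i)]
  simp only [dotProduct, Fintype.sum_prod_type]
  rw [Finset.sum_comm]
  refine Finset.sum_congr rfl fun i _ => Finset.sum_congr rfl fun a _ => ?_
  congr 1
  simp only [Matrix.mulVec, dotProduct, Fintype.sum_prod_type, Matrix.blockDiagonal_apply]
  refine Finset.sum_congr rfl fun b _ => ?_
  simp

theorem dotProduct_matH_mulVec (R : ℕ → Matrix (Fin m) (Fin m) ℝ) (z : Fin l → ℝ) :
    z ⬝ᵥ matH r h q K R *ᵥ z = ∑ i ∈ Finset.range (r - 1), (q (i + 1) * h) ^ r *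
      (K (i + 1) *ᵥ z ⬝ᵥ R (i + 1) *ᵥ (K (i + 1) *ᵥ z)) := by
  rw [matH, Matrix.sum_mulVec, dotProduct_sum, Finset.range_eq_Ico,
    Finset.sum_Ico_add' (fun i => ((q i : ℝ) * h) ^ r * (K i *ᵥ z ⬝ᵥ R i *ᵥ (K i *ᵥ z)))]
  refine Finset.sum_congr (Finset.Ico_add_one_right_eq_Icc _ _).symm fun i _ => ?_
  rw [Matrix.smul_mulVec, dotProduct_smul, smul_eq_mul, Matrix.mul_assoc, ← Matrix.mulVec_mulVec,
    dotProduct_transpose_mulVec, Matrix.mulVec_mulVec]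

theorem dotProduct_Phi11_mulVec {P : Matrix (Fin n) (Fin n) ℝ} (hP : Pᵀ = P)
    (W : ℕ → Matrix (Fin m) (Fin m) ℝ) (v : Fin n → ℝ) :
    v ⬝ᵥ Phi11 A B C r h q K α P W *ᵥ v =
      2 * (v ⬝ᵥ P *ᵥ (matD A B C r h q K *ᵥ v)) + 2 * α * (v ⬝ᵥ P *ᵥ v) +
        ∑ i ∈ Finset.range r, h ^ 2 * Real.exp (2 * α * h) *
          (K i *ᵥ ((C * A) *ᵥ v) ⬝ᵥ W i *ᵥ (K i *ᵥ ((C * A) *ᵥ v))) := by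
  have hD : v ⬝ᵥ ((matD A B C r h q K)ᵀ * P) *ᵥ v =
      v ⬝ᵥ P *ᵥ (matD A B C r h q K *ᵥ v) := by
    rw [← Matrix.mulVec_mulVec, dotProduct_transpose_mulVec, dotProduct_comm]
    conv_lhs => rw [← hP]
    rw [← dotProduct_transpose_mulVec, Matrix.transpose_transpose]
  have hsum : v ⬝ᵥ (∑ i ∈ Finset.range r, (K i * C * A)ᵀ * W i * (K i * C * A)) *ᵥ v =
      ∑ i ∈ Finset.range r,
        (K i *ᵥ ((C * A) *ᵥ v) ⬝ᵥ W i *ᵥ (K i *ᵥ ((C * A) *ᵥ v))) := by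
    rw [Matrix.sum_mulVec, dotProduct_sum]
    refine Finset.sum_congr rfl fun i _ => ?_
    rw [Matrix.mul_assoc _ (W i), ← Matrix.mulVec_mulVec, dotProduct_transpose_mulVec,
      Matrix.mulVec_mulVec, Matrix.mulVec_mulVec, Matrix.mul_assoc (K i)]
  rw [Phi11, Matrix.add_mulVec, Matrix.add_mulVec, Matrix.add_mulVec, dotProduct_add,
    dotProduct_add, dotProduct_add, hD, Matrix.smul_mulVec, Matrix.smul_mulVec, dotProduct_smul,
    dotProduct_smul, hsum, ← Matrix.mulVec_mulVec, smul_eq_mul, smul_eq_mul, Finset.mul_sum]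
  ring

theorem dotProduct_Phi22_mulVec (W : ℕ → Matrix (Fin m) (Fin m) ℝ) (d : ℕ → Fin m → ℝ) :
    (fun p : Fin m × Fin r => d p.2 p.1) ⬝ᵥ Phi22 r h q α W *ᵥ
      (fun p : Fin m × Fin r => d p.2 p.1) =
      -∑ i ∈ Finset.range r, Real.pi ^ 2 / 4 * Real.exp (-2 * α * (q i * h)) *
          (d i ⬝ᵥ W i *ᵥ d i) := by
  rw [Phi22, Matrix.smul_mulVec, dotProduct_smul, dotProduct_blockDiagonal_mulVec
    (fun i => Real.exp (-2 * α * ((q i : ℝ) * h)) • W i) d, smul_eq_mul, neg_mul, Finset.mul_sum]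
  congr 1
  refine Finset.sum_congr rfl fun i _ => ?_
  rw [Matrix.smul_mulVec, dotProduct_smul, smul_eq_mul]
  ring

theorem dotProduct_Phi33_mulVec (R : ℕ → Matrix (Fin m) (Fin m) ℝ) (e : ℕ → Fin m → ℝ) :
    (fun p : Fin m × Fin (r - 1) => e (p.2 + 1) p.1) ⬝ᵥ Phi33 r h q α R *ᵥ
      (fun p : Fin m × Fin (r - 1) => e (p.2 + 1) p.1) =
      -∑ i ∈ Finset.range (r - 1), (r ! : ℝ) ^ 2 / (q (i + 1) * h) ^ r *
          Real.exp (-2 * α * (q (i + 1) * h)) * (e (i + 1) ⬝ᵥ R (i + 1) *ᵥ e (i + 1)) := by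
  rw [Phi33, Matrix.smul_mulVec, dotProduct_smul, dotProduct_blockDiagonal_mulVec
    (fun i => (Real.exp (-2 * α * ((q (i + 1) : ℝ) * h)) / ((q (i + 1) : ℝ) * h) ^ r) •
      R (i + 1)) (fun i => e (i + 1)), smul_eq_mul, neg_mul, Finset.mul_sum]
  congr 1
  refine Finset.sum_congr rfl fun i _ => ?_
  rw [Matrix.smul_mulVec, dotProduct_smul, smul_eq_mul]
  ring

theorem dotProduct_Phi_mulVec (P : Matrix (Fin n) (Fin n) ℝ) (W R : ℕ → Matrix (Fin m) (Fin m) ℝ)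
    (v : Fin n → ℝ) (d e : ℕ → Fin m → ℝ) (z : Fin l → ℝ) :
    let w := Sum.elim (Sum.elim v fun p : Fin m × Fin r => d p.2 p.1)
      (Sum.elim (fun p : Fin m × Fin (r - 1) => e (p.2 + 1) p.1) z)
    let σ := ∑ i ∈ Finset.range r, d i
    let τ := ∑ i ∈ Finset.range (r - 1), e (i + 1)
    w ⬝ᵥ Phi A B C r h q K α P W R *ᵥ w =
      v ⬝ᵥ Phi11 A B C r h q K α P W *ᵥ v +
      (fun p : Fin m × Fin r => d p.2 p.1) ⬝ᵥ Phi22 r h q α W *ᵥ (fun p => d p.2 p.1) +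
      (fun p : Fin m × Fin (r - 1) => e (p.2 + 1) p.1) ⬝ᵥ
        Phi33 r h q α R *ᵥ (fun p => e (p.2 + 1) p.1) - z ⬝ᵥ matH r h q K R *ᵥ z +
      2 * (v ⬝ᵥ P *ᵥ (B *ᵥ (σ + τ))) +
      2 * ((C * A ^ (r - 1)) *ᵥ (matD A B C r h q K *ᵥ v + B *ᵥ σ + B *ᵥ τ) ⬝ᵥ
        matH r h q K R *ᵥ z) := by
  intro w σ τ
  have hcross : ∀ {k : ℕ} (X : Matrix (Fin n) (Fin k) ℝ) (u : Fin k → ℝ),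
      u ⬝ᵥ ((C * A ^ (r - 1) * X)ᵀ * matH r h q K R) *ᵥ z =
        (C * A ^ (r - 1)) *ᵥ (X *ᵥ u) ⬝ᵥ matH r h q K R *ᵥ z := fun X u => by
    rw [← Matrix.mulVec_mulVec, dotProduct_transpose_mulVec, ← Matrix.mulVec_mulVec _ _ X]
  simp only [w, Phi, dotProduct_fromBlocks_mulVec_self]
  rw [Matrix.fromBlocks_mulVec, sumElim_dotProduct_sumElim, Sum.elim_comp_inl, Sum.elim_comp_inr,
    repeatRow_mulVec, repeatRow_mulVec _ fun i => e (i + 1), Matrix.zero_mulVec, zero_add,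
    dotProduct_repeatCol_mulVec, dotProduct_repeatCol_mulVec _ fun i => e (i + 1), dotProduct_add,
    hcross, hcross, hcross, Matrix.neg_mulVec, dotProduct_neg]
  simp only [Matrix.mulVec_add, dotProduct_add, add_dotProduct, ← Matrix.mulVec_mulVec _ P]
  ring

theorem dissipation_of_Phi {P : Matrix (Fin n) (Fin n) ℝ} {W R : ℕ → Matrix (Fin m) (Fin m) ℝ}
    (hP : Pᵀ = P) (hPhi : (-Phi A B C r h q K α P W R).PosSemidef) :
    Dissipation A B C r h q K α P W R := by
  intro v y d e hy
  have hform := hPhi.dotProduct_mulVec_nonneg (Sum.elim (Sum.elim v fun p => d p.2 p.1)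
    (Sum.elim (fun p => e (p.2 + 1) p.1) ((C * A ^ (r - 1)) *ᵥ y)))
  rw [star_trivial, Matrix.neg_mulVec, dotProduct_neg, dotProduct_Phi_mulVec, ← hy,
    dotProduct_Phi11_mulVec hP, dotProduct_Phi22_mulVec, dotProduct_Phi33_mulVec] at hform
  have hPy : v ⬝ᵥ P *ᵥ y = v ⬝ᵥ P *ᵥ (matD A B C r h q K *ᵥ v) + v ⬝ᵥ P *ᵥ (B *ᵥ
      (∑ i ∈ Finset.range r, d i + ∑ i ∈ Finset.range (r - 1), e (i + 1))) := by
    rw [hy, add_assoc, ← Matrix.mulVec_add, Matrix.mulVec_add P, dotProduct_add]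
  rw [← dotProduct_matH_mulVec]
  linarith

theorem isExpStable_of_Phi (hr : 2 ≤ r) (hCB : ∀ i, i + 2 ≤ r → C * A ^ i * B = 0)
    (hh : 0 < h) (hq0 : q 0 = 0) (hq : ∀ i, i + 1 < r → q i < q (i + 1)) (hα : 0 ≤ α)
    {P : Matrix (Fin n) (Fin n) ℝ} {W R : ℕ → Matrix (Fin m) (Fin m) ℝ} (hP : P.PosDef)
    (hW : ∀ i < r, (W i).PosSemidef) (hR : ∀ i, 1 ≤ i → i < r → (R i).PosSemidef)
    (hPhi : (-Phi A B C r h q K α P W R).PosSemidef) :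
    IsExpStable (IsSampledLoop A B C r h q K) α :=
  (dissipation_of_Phi ((Matrix.conjTranspose_eq_transpose_of_trivial P).symm.trans
    hP.isHermitian) hPhi).isExpStable hr hCB hh hq0 hq hα hP hW hR

end MatrixInequality
section DerivativeLoop

variable {n m l : ℕ} {A : Matrix (Fin n) (Fin n) ℝ} {B : Matrix (Fin n) (Fin m) ℝ}
  {C : Matrix (Fin l) (Fin n) ℝ} {r : ℕ} {α β : ℝ}

theorem IsExpStable.mono {Loop : (ℝ → Fin n → ℝ) → Prop} (hβ : IsExpStable Loop β)
    (hαβ : α ≤ β) : IsExpStable Loop α := by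
  obtain ⟨hex, c, hc⟩ := hβ
  refine ⟨hex, |c|, fun x hx t ht => (hc x hx t ht).trans ?_⟩
  gcongr
  exact le_abs_self c

theorem gainRow_mul_outputCol_mulVec (K : ℕ → Matrix (Fin m) (Fin l) ℝ) (v : Fin n → ℝ) :
    (gainRow r K * outputCol A C r) *ᵥ v = ∑ i ∈ Finset.range r, K i *ᵥ ((C * A ^ i) *ᵥ v) := by
  rw [← Matrix.mulVec_mulVec, gainRow_mulVec,
    ← Fin.sum_univ_eq_sum_range fun i => K i *ᵥ ((C * A ^ i) *ᵥ v)]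
  rfl

theorem iteratedDerivWithin_output (hCB : ∀ i, i + 2 ≤ r → C * A ^ i * B = 0)
    {u : ℝ → Fin m → ℝ} {x : ℝ → Fin n → ℝ}
    (hx : ∀ t, 0 ≤ t → HasDerivWithinAt x (A *ᵥ x t + B *ᵥ u t) (Ici 0) t) {i : ℕ} (hi : i < r)
    {t : ℝ} (ht : 0 ≤ t) :
    iteratedDerivWithin i (output C x) (Ici 0) t = (C * A ^ i) *ᵥ x t := by
  induction i generalizing t with
  | zero => simp [output, ht]
  | succ i ih =>
    have hderiv := (mulVecCLM (C * A ^ i)).hasFDerivAt.comp_hasDerivWithinAt t (hx t ht)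
    rw [iteratedDerivWithin_succ, derivWithin_congr (s := Ici 0)
      (f := fun s => (C * A ^ i) *ᵥ x s) (fun s hs => ih (by omega) hs) (ih (by omega) ht)]
    refine (hderiv.derivWithin (uniqueDiffOn_Ici 0 t ht)).trans ?_
    rw [mulVecCLM_apply, Matrix.mulVec_add, Matrix.mulVec_mulVec, Matrix.mulVec_mulVec,
      hCB i (by omega), Matrix.zero_mulVec, add_zero, Matrix.mul_assoc, ← pow_succ]

theorem isDerivativeLoop_flow (hCB : ∀ i, i + 2 ≤ r → C * A ^ i * B = 0)
    (Kbar : ℕ → Matrix (Fin m) (Fin l) ℝ) (x₀ : Fin n → ℝ) :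
    IsDerivativeLoop A B C r Kbar fun t =>
      flow (mulVecCLM (A + B * (gainRow r Kbar * outputCol A C r))) t x₀ := by
  let D := A + B * (gainRow r Kbar * outputCol A C r)
  let x (t : ℝ) := flow (mulVecCLM D) t x₀
  have hx : ∀ t, HasDerivAt x
      (A *ᵥ x t + B *ᵥ ((gainRow r Kbar * outputCol A C r) *ᵥ x t)) t := fun t =>
    (hasDerivAt_flow_apply (mulVecCLM D) x₀ t).congr_deriv (by
      rw [mulVecCLM_apply, Matrix.add_mulVec, Matrix.mulVec_mulVec])
  refine ⟨fun t => (gainRow r Kbar * outputCol A C r) *ᵥ x t,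
    ⟨fun t _ => (hx t).continuousAt.continuousWithinAt, fun t _ => (hx t).hasDerivWithinAt⟩,
    fun t ht => (gainRow_mul_outputCol_mulVec Kbar (x t)).trans ?_⟩
  exact Finset.sum_congr rfl fun i hi => by
    rw [iteratedDerivWithin_output hCB (fun t _ => (hx t).hasDerivWithinAt)
      (Finset.mem_range.1 hi) ht]

end DerivativeLoop

section Gramian

open scoped Matrix.Norms.L2Operator

variable {n : ℕ}

theorem norm_toLp_sq {k : ℕ} (v : Fin k → ℝ) : ‖WithLp.toLp 2 v‖ ^ 2 = v ⬝ᵥ v :=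
  (EuclideanSpace.real_norm_sq_eq _).trans (Finset.sum_congr rfl fun _ _ => sq _)

variable (D : Matrix (Fin n) (Fin n) ℝ) (α T : ℝ)

/-- The integrand `(e^{t D})ᵀ e^{t D}` of the Gramian, with its weight `e^{2 α t}`. -/
def gramianKernel (t : ℝ) : Matrix (Fin n) (Fin n) ℝ :=
  Real.exp (2 * α * t) • ((LinearMap.toMatrix' (flow (mulVecCLM D) t).toLinearMap)ᵀ *
    LinearMap.toMatrix' (flow (mulVecCLM D) t).toLinearMap)

/-- The finite-horizon Gramian `∫₀ᵀ e^{2 α t} (e^{t D})ᵀ e^{t D} dt`, which serves as Lyapunov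
matrix for `x' = D x`. -/
def gramian : Matrix (Fin n) (Fin n) ℝ := ∫ t in (0 : ℝ)..T, gramianKernel D α t

theorem dotProduct_gramianKernel_mulVec (t : ℝ) (v w : Fin n → ℝ) :
    v ⬝ᵥ gramianKernel D α t *ᵥ w =
      Real.exp (2 * α * t) * (flow (mulVecCLM D) t v ⬝ᵥ flow (mulVecCLM D) t w) := by
  rw [gramianKernel, Matrix.smul_mulVec, dotProduct_smul, ← Matrix.mulVec_mulVec,
    dotProduct_transpose_mulVec, LinearMap.toMatrix'_mulVec, LinearMap.toMatrix'_mulVec]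
  rfl

theorem continuous_gramianKernel : Continuous (gramianKernel D α) := by
  let toMat : ((Fin n → ℝ) →L[ℝ] (Fin n → ℝ)) →ₗ[ℝ] Matrix (Fin n) (Fin n) ℝ :=
    LinearMap.toMatrix'.toLinearMap ∘ₗ ContinuousLinearMap.coeLM ℝ
  have hE : Continuous fun t => toMat (flow (mulVecCLM D) t) :=
    toMat.continuous_of_finiteDimensional.comp (continuous_flow _)
  have hexp : Continuous fun t : ℝ => Real.exp (2 * α * t) := by fun_prop
  exact hexp.smul (hE.matrix_transpose.mul hE)

theorem dotProduct_gramian_mulVec (v w : Fin n → ℝ) :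
    v ⬝ᵥ gramian D α T *ᵥ w = ∫ t in (0 : ℝ)..T,
      Real.exp (2 * α * t) * (flow (mulVecCLM D) t v ⬝ᵥ flow (mulVecCLM D) t w) := by
  let form : Matrix (Fin n) (Fin n) ℝ →ₗ[ℝ] ℝ :=
    LinearMap.applyₗ w ∘ₗ LinearMap.applyₗ v ∘ₗ (Matrix.toLinearMap₂' ℝ).toLinearMap
  have hform : ∀ M, form M = v ⬝ᵥ M *ᵥ w := fun M => Matrix.toLinearMap₂'_apply' M v w
  have hcomm := form.toContinuousLinearMap.intervalIntegral_comp_comm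
    ((continuous_gramianKernel D α).intervalIntegrable (μ := volume) 0 T)
  simp only [LinearMap.coe_toContinuousLinearMap', hform, dotProduct_gramianKernel_mulVec] at hcomm
  exact hcomm.symm

theorem isSymm_gramian : (gramian D α T).IsSymm := by
  have hsymm : ∀ v w, v ⬝ᵥ gramian D α T *ᵥ w = w ⬝ᵥ gramian D α T *ᵥ v := fun v w => by
    rw [dotProduct_gramian_mulVec, dotProduct_gramian_mulVec]
    simp only [dotProduct_comm]
  ext i j
  simpa using hsymm (Pi.single j 1) (Pi.single i 1)

theorem continuous_exp_mul_dotProduct_flow (v w : Fin n → ℝ) : Continuous fun t =>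
    Real.exp (2 * α * t) * (flow (mulVecCLM D) t v ⬝ᵥ flow (mulVecCLM D) t w) := by
  have hflow : ∀ v, Continuous fun t => flow (mulVecCLM D) t v := fun v =>
    (continuous_flow _).clm_apply continuous_const
  have hexp : Continuous fun t : ℝ => Real.exp (2 * α * t) := by fun_prop
  exact hexp.mul ((hflow v).dotProduct (hflow w))

theorem posDef_gramian {T : ℝ} (hT : 0 < T) : (gramian D α T).PosDef := by
  refine .of_dotProduct_mulVec_pos ?_ fun v hv => ?_
  · exact (Matrix.conjTranspose_eq_transpose_of_trivial _).trans (isSymm_gramian D α T)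
  rw [star_trivial, dotProduct_gramian_mulVec]
  refine intervalIntegral_pos_of_pos
    ((continuous_exp_mul_dotProduct_flow D α v v).intervalIntegrable 0 T)
    (fun t => mul_pos (Real.exp_pos _) ?_) hT
  have hinj : flow (mulVecCLM D) t v ≠ 0 := fun h0 => hv (by
    rw [← flow_apply_flow_neg (mulVecCLM D) (-t) v, neg_neg, h0, map_zero])
  exact (Finset.sum_nonneg fun i _ => mul_self_nonneg _).lt_of_ne'
    (dotProduct_self_eq_zero.not.2 hinj)

theorem gramian_lyapunov_equation (v : Fin n → ℝ) :
    2 * (v ⬝ᵥ gramian D α T *ᵥ (D *ᵥ v)) + 2 * α * (v ⬝ᵥ gramian D α T *ᵥ v) =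
      Real.exp (2 * α * T) * (flow (mulVecCLM D) T v ⬝ᵥ flow (mulVecCLM D) T v) - v ⬝ᵥ v := by
  let g (t : ℝ) := Real.exp (2 * α * t) * (flow (mulVecCLM D) t v ⬝ᵥ flow (mulVecCLM D) t v)
  let g' (t : ℝ) :=
    2 * (Real.exp (2 * α * t) * (flow (mulVecCLM D) t v ⬝ᵥ flow (mulVecCLM D) t (D *ᵥ v))) +
      2 * α * g t
  have hg : ∀ t, HasDerivAt g (g' t) t := fun t => by
    obtain ⟨S, hS⟩ := exists_sqrt_form (Matrix.PosSemidef.one (n := Fin n) (R := ℝ))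
    have hflow := S.hasFDerivAt.comp_hasDerivAt t (hasDerivAt_flow_apply (mulVecCLM D) v t)
    have hexp := ((hasDerivAt_id t).const_mul (2 * α)).exp
    refine ((hexp.mul hflow.norm_sq).congr_of_eventuallyEq (.of_forall fun s => ?_)).congr_deriv ?_
    · simp only [g, Pi.mul_apply, Function.comp_apply, id, ← real_inner_self_eq_norm_sq, hS,
        Matrix.one_mulVec]
    · simp only [g', g, Function.comp_apply, id, ← real_inner_self_eq_norm_sq, hS,
        Matrix.one_mulVec, ← flow_apply_comm, mulVecCLM_apply]
      ring
  have hg' := fun w => (continuous_exp_mul_dotProduct_flow D α v w).intervalIntegrable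
    (μ := volume) 0 T
  have hftc := integral_eq_sub_of_hasDerivAt (fun t _ => hg t)
    (((hg' (D *ᵥ v)).const_mul 2).add ((hg' v).const_mul (2 * α)))
  rw [intervalIntegral.integral_add ((hg' _).const_mul 2) ((hg' v).const_mul (2 * α)),
    intervalIntegral.integral_const_mul, intervalIntegral.integral_const_mul,
    ← dotProduct_gramian_mulVec, ← dotProduct_gramian_mulVec] at hftc
  simpa [g, flow_zero] using hftc

theorem exists_lyapunov {D : Matrix (Fin n) (Fin n) ℝ} {α β c : ℝ} (hαβ : α < β)
    (hc : ∀ v, ∀ t, 0 ≤ t → ‖WithLp.toLp 2 (flow (mulVecCLM D) t v)‖ ≤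
      c * Real.exp (-β * t) * ‖WithLp.toLp 2 v‖) :
    ∃ P : Matrix (Fin n) (Fin n) ℝ, P.PosDef ∧ ∀ v,
      2 * (v ⬝ᵥ P *ᵥ (D *ᵥ v)) + 2 * α * (v ⬝ᵥ P *ᵥ v) ≤ -(1 / 2) * ‖WithLp.toLp 2 v‖ ^ 2 := by
  obtain ⟨T, hT, hcT⟩ : ∃ T : ℝ, 0 < T ∧ c ^ 2 * Real.exp (-(2 * (β - α) * T)) < 1 / 2 := by
    have hlim : Tendsto (fun T : ℝ => c ^ 2 * Real.exp (-(2 * (β - α) * T))) atTop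
        (𝓝 (c ^ 2 * 0)) :=
      (Real.tendsto_exp_neg_atTop_nhds_zero.comp
        (tendsto_id.const_mul_atTop (by linarith))).const_mul _
    rw [mul_zero] at hlim
    exact ((eventually_gt_atTop 0).and (hlim.eventually_lt_const (by norm_num))).exists
  refine ⟨gramian D α T, posDef_gramian D α hT, fun v => ?_⟩
  rw [gramian_lyapunov_equation, ← norm_toLp_sq, ← norm_toLp_sq]
  have hdecay : Real.exp (2 * α * T) * ‖WithLp.toLp 2 (flow (mulVecCLM D) T v)‖ ^ 2 ≤
      1 / 2 * ‖WithLp.toLp 2 v‖ ^ 2 := by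
    calc _ ≤ Real.exp (2 * α * T) * (c * Real.exp (-β * T) * ‖WithLp.toLp 2 v‖) ^ 2 := by
          gcongr
          exact hc v T hT.le
      _ = c ^ 2 * Real.exp (-(2 * (β - α) * T)) * ‖WithLp.toLp 2 v‖ ^ 2 := by
          rw [show -(2 * (β - α) * T) = 2 * α * T + -β * T + -β * T by ring, Real.exp_add,
            Real.exp_add]
          ring
      _ ≤ 1 / 2 * ‖WithLp.toLp 2 v‖ ^ 2 := by gcongr
  linarith

end Gramian
section Vandermonde

open scoped Kronecker Matrix.Norms.L2Operator

/-- The scalar matrix `((-i)^j / j!)`, `i, j = 0, …, r - 1`: the matrix `vandermondeM` for `l = 1`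
and `q i * h = i`. -/
def unitVandermonde (r : ℕ) : Matrix (Fin r) (Fin r) ℝ :=
  Matrix.of fun i j => (-(i : ℝ)) ^ (j : ℕ) / ((j : ℕ)! : ℝ)

theorem isUnit_det_unitVandermonde (r : ℕ) : IsUnit (unitVandermonde r).det := by
  have hfactor : unitVandermonde r = Matrix.vandermonde (fun i : Fin r => -(i : ℝ)) *
      Matrix.diagonal fun j : Fin r => (((j : ℕ)! : ℝ))⁻¹ := by
    ext i j
    rw [Matrix.mul_diagonal, Matrix.vandermonde_apply, unitVandermonde, Matrix.of_apply,
      div_eq_mul_inv]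
  rw [hfactor, Matrix.det_mul, Matrix.det_diagonal, isUnit_iff_ne_zero]
  refine mul_ne_zero (Matrix.det_vandermonde_ne_zero_iff.2 fun i j hij => ?_)
    (Finset.prod_ne_zero_iff.2 fun j _ => by positivity)
  exact Fin.ext (by exact_mod_cast neg_injective hij)

theorem inv_unitVandermonde_mul_diagonal_pow (r : ℕ) {η : ℝ} (hη : η ≠ 0) :
    (unitVandermonde r * Matrix.diagonal fun j : Fin r => η ^ (j : ℕ))⁻¹ =
      (Matrix.diagonal fun j : Fin r => (η ^ (j : ℕ))⁻¹) * (unitVandermonde r)⁻¹ := by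
  rw [Matrix.mul_inv_rev]
  congr 1
  refine Matrix.inv_eq_right_inv ?_
  rw [Matrix.diagonal_mul_diagonal, ← Matrix.diagonal_one]
  exact congrArg _ (funext fun j => mul_inv_cancel₀ (pow_ne_zero _ hη))

variable {m l r : ℕ} {h : ℝ} {q : ℕ → ℕ} {p : ℕ}

theorem vandermondeM_eq_kronecker (l : ℕ) (hq : ∀ i, q i = i * p) :
    vandermondeM l r h q = (1 : Matrix (Fin l) (Fin l) ℝ) ⊗ₖ
      (unitVandermonde r * Matrix.diagonal fun j : Fin r => ((p : ℝ) * h) ^ (j : ℕ)) := by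
  ext a b
  rw [Matrix.kronecker_apply, Matrix.mul_diagonal, vandermondeM, unitVandermonde, Matrix.of_apply,
    Matrix.of_apply, hq]
  push_cast
  rw [show -((a.2 : ℝ) * p * h) = -(a.2 : ℝ) * (p * h) by ring, mul_pow]
  ring

theorem isUnit_det_vandermondeM (l : ℕ) (hq : ∀ i, q i = i * p) (hp : (p : ℝ) * h ≠ 0) :
    IsUnit (vandermondeM l r h q).det := by
  rw [vandermondeM_eq_kronecker l hq, Matrix.det_kronecker, Matrix.det_one, one_pow, one_mul,
    Matrix.det_mul, Matrix.det_diagonal]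
  refine IsUnit.pow _ ((isUnit_det_unitVandermonde r).mul (isUnit_iff_ne_zero.2 ?_))
  exact Finset.prod_ne_zero_iff.2 fun j _ => pow_ne_zero _ hp

variable {K Kbar : ℕ → Matrix (Fin m) (Fin l) ℝ}

theorem eq_sum_smul_of_gainRow_mul_kronecker {G : Matrix (Fin r) (Fin r) ℝ}
    (hK : gainRow r K = gainRow r Kbar * ((1 : Matrix (Fin l) (Fin l) ℝ) ⊗ₖ G)) (i : Fin r) :
    K i = ∑ j : Fin r, G j i • Kbar j := by
  ext a b
  have hentry := congrFun (congrFun hK a) (b, i)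
  rw [gainRow, Matrix.of_apply, Matrix.mul_apply, Fintype.sum_prod_type] at hentry
  simp only [gainRow, Matrix.of_apply, Matrix.kronecker_apply, Matrix.one_apply, ite_mul, one_mul,
    zero_mul, mul_ite, mul_zero] at hentry
  rw [hentry, Finset.sum_comm, Matrix.sum_apply]
  simp [mul_comm]

theorem gain_eq_sum_smul (hq : ∀ i, q i = i * p) (hp : (p : ℝ) * h ≠ 0)
    (hK : gainRow r K = gainRow r Kbar * (vandermondeM l r h q)⁻¹) (i : Fin r) :
    K i = ∑ j : Fin r, ((((p : ℝ) * h) ^ (j : ℕ))⁻¹ * (unitVandermonde r)⁻¹ j i) • Kbar j := by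
  rw [vandermondeM_eq_kronecker l hq, Matrix.inv_kronecker, inv_one,
    inv_unitVandermonde_mul_diagonal_pow r hp] at hK
  rw [eq_sum_smul_of_gainRow_mul_kronecker hK]
  simp only [Matrix.diagonal_mul]

theorem pow_mul_norm_gain_le (hq : ∀ i, q i = i * p) (hp0 : 0 < (p : ℝ) * h)
    (hp1 : (p : ℝ) * h ≤ 1) (hK : gainRow r K = gainRow r Kbar * (vandermondeM l r h q)⁻¹)
    (i : ℕ) (hi : i < r) :
    ((p : ℝ) * h) ^ (r - 1) * ‖K i‖ ≤
      ∑ i : Fin r, ∑ j : Fin r, |(unitVandermonde r)⁻¹ j i| * ‖Kbar j‖ := by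
  set η := (p : ℝ) * h
  have hterm : ∀ j : Fin r, η ^ (r - 1) * ‖((η ^ (j : ℕ))⁻¹ * (unitVandermonde r)⁻¹ j ⟨i, hi⟩) •
      Kbar j‖ ≤ |(unitVandermonde r)⁻¹ j ⟨i, hi⟩| * ‖Kbar j‖ := fun j => by
    rw [norm_smul, Real.norm_eq_abs, abs_mul, abs_of_pos (inv_pos.2 (pow_pos hp0 _)), ← mul_assoc,
      ← mul_assoc, mul_assoc (_ * _)]
    refine mul_le_of_le_one_left (by positivity) ?_
    rw [← div_eq_mul_inv]
    exact div_le_one_of_le₀ (pow_le_pow_of_le_one hp0.le hp1 (by omega)) (by positivity)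
  rw [show K i = _ from gain_eq_sum_smul hq hp0.ne' hK ⟨i, hi⟩]
  calc _ ≤ η ^ (r - 1) * ∑ j : Fin r, ‖((η ^ (j : ℕ))⁻¹ * (unitVandermonde r)⁻¹ j ⟨i, hi⟩) •
        Kbar j‖ := by gcongr; exact norm_sum_le _ _
    _ ≤ ∑ j : Fin r, |(unitVandermonde r)⁻¹ j ⟨i, hi⟩| * ‖Kbar j‖ := by
        rw [Finset.mul_sum]
        exact Finset.sum_le_sum fun j _ => hterm j
    _ ≤ _ := Finset.single_le_sum
        (f := fun i : Fin r => ∑ j : Fin r, |(unitVandermonde r)⁻¹ j i| * ‖Kbar j‖)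
        (fun i _ => by positivity) (Finset.mem_univ _)

end Vandermonde

section SmallDelay

open scoped Matrix.Norms.L2Operator

local notation "‖" v "‖₂" => norm (WithLp.toLp 2 v)

variable {n m l : ℕ}

theorem norm_toLp_mulVec_le {k : ℕ} (M : Matrix (Fin m) (Fin k) ℝ) (v : Fin k → ℝ) :
    ‖M *ᵥ v‖₂ ≤ ‖M‖ * ‖v‖₂ :=
  Matrix.l2_opNorm_mulVec M (WithLp.toLp 2 v)

theorem norm_add_sq_le (v w : Fin m → ℝ) : ‖v + w‖₂ ^ 2 ≤ 2 * (‖v‖₂ ^ 2 + ‖w‖₂ ^ 2) :=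
  (pow_le_pow_left₀ (norm_nonneg _) (norm_add_le (WithLp.toLp 2 v) (WithLp.toLp 2 w)) 2).trans
    add_sq_le

theorem norm_sum_sq_le {ι : Type*} (s : Finset ι) (f : ι → Fin m → ℝ) :
    ‖∑ i ∈ s, f i‖₂ ^ 2 ≤ s.card * ∑ i ∈ s, ‖f i‖₂ ^ 2 := by
  rw [WithLp.toLp_sum]
  exact (pow_le_pow_left₀ (norm_nonneg _) (norm_sum_le _ _) 2).trans sq_sum_le_card_mul_sum_sq

theorem two_mul_dotProduct_le (v w : Fin m → ℝ) :
    2 * (v ⬝ᵥ w) ≤ 1 / 4 * ‖v‖₂ ^ 2 + 4 * ‖w‖₂ ^ 2 := by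
  have hsq := norm_toLp_sq ((1 / 2 : ℝ) • v - (2 : ℝ) • w)
  simp only [sub_dotProduct, dotProduct_sub, smul_dotProduct, dotProduct_smul, smul_eq_mul,
    dotProduct_comm w v] at hsq
  rw [norm_toLp_sq, norm_toLp_sq]
  nlinarith [sq_nonneg ‖(1 / 2 : ℝ) • v - (2 : ℝ) • w‖₂]

theorem dotProduct_smul_one_mulVec (c : ℝ) (w : Fin m → ℝ) :
    w ⬝ᵥ (c • (1 : Matrix (Fin m) (Fin m) ℝ)) *ᵥ w = c * ‖w‖₂ ^ 2 := by
  rw [Matrix.smul_mulVec, Matrix.one_mulVec, dotProduct_smul, smul_eq_mul, norm_toLp_sq]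

theorem norm_sum_add_sum_sq_le {r : ℕ} (d e : ℕ → Fin m → ℝ) :
    ‖∑ i ∈ Finset.range r, d i + ∑ i ∈ Finset.range (r - 1), e (i + 1)‖₂ ^ 2 ≤
      2 * r * (∑ i ∈ Finset.range r, ‖d i‖₂ ^ 2 +
        ∑ i ∈ Finset.range (r - 1), ‖e (i + 1)‖₂ ^ 2) := by
  have hd := norm_sum_sq_le (Finset.range r) d
  have he : ‖∑ i ∈ Finset.range (r - 1), e (i + 1)‖₂ ^ 2 ≤
      r * ∑ i ∈ Finset.range (r - 1), ‖e (i + 1)‖₂ ^ 2 := by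
    refine (norm_sum_sq_le (Finset.range (r - 1)) fun i => e (i + 1)).trans ?_
    rw [Finset.card_range]
    gcongr
    omega
  rw [Finset.card_range] at hd
  linarith [norm_add_sq_le (∑ i ∈ Finset.range r, d i) (∑ i ∈ Finset.range (r - 1), e (i + 1))]

theorem eventually_mul_le (a : ℝ) {b : ℝ} (hb : 0 < b) : ∀ᶠ η in 𝓝[>] (0 : ℝ), η * a ≤ b :=
  (((continuous_mul_const a).tendsto' 0 0 (zero_mul a)).mono_left
    nhdsWithin_le_nhds).eventually_le_const hb

variable {A D P : Matrix (Fin n) (Fin n) ℝ} {B : Matrix (Fin n) (Fin m) ℝ}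
  {C : Matrix (Fin l) (Fin n) ℝ} {r : ℕ} {h η α L : ℝ} {K : ℕ → Matrix (Fin m) (Fin l) ℝ}

theorem lyapunov_perturbed_le
    (hP : ∀ v, 2 * (v ⬝ᵥ P *ᵥ (D *ᵥ v)) + 2 * α * (v ⬝ᵥ P *ᵥ v) ≤ -(1 / 2) * ‖v‖₂ ^ 2)
    (v : Fin n → ℝ) (w : Fin m → ℝ) :
    2 * (v ⬝ᵥ P *ᵥ (D *ᵥ v + B *ᵥ w)) + 2 * α * (v ⬝ᵥ P *ᵥ v) ≤
      -(1 / 4) * ‖v‖₂ ^ 2 + 4 * ‖P * B‖ ^ 2 * ‖w‖₂ ^ 2 := by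
  have hcross := two_mul_dotProduct_le v ((P * B) *ᵥ w)
  have hPB := pow_le_pow_left₀ (norm_nonneg _) (norm_toLp_mulVec_le (P * B) w) 2
  rw [mul_pow] at hPB
  rw [Matrix.mulVec_add, dotProduct_add, Matrix.mulVec_mulVec w]
  linarith [hP v]

theorem pow_sq_mul_norm_mulVec_sq_le (hη : 0 ≤ η) {M : Matrix (Fin m) (Fin l) ℝ}
    (hM : η ^ (r - 1) * ‖M‖ ≤ L) (z : Fin l → ℝ) :
    (η ^ (r - 1)) ^ 2 * ‖M *ᵥ z‖₂ ^ 2 ≤ L ^ 2 * ‖z‖₂ ^ 2 := by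
  rw [← mul_pow, ← mul_pow]
  gcongr ?_ ^ 2
  calc _ ≤ η ^ (r - 1) * (‖M‖ * ‖z‖₂) := by gcongr; exact norm_toLp_mulVec_le M z
    _ = η ^ (r - 1) * ‖M‖ * ‖z‖₂ := by ring
    _ ≤ L * ‖z‖₂ := by gcongr

theorem sum_sampling_le (hr : r ≠ 0) (hα : 0 ≤ α) (hh : 0 ≤ h) (hh1 : h ≤ 1) (hη : 0 < η)
    (hhη : h ≤ (2 * η) ^ r) (hK : ∀ i < r, η ^ (r - 1) * ‖K i‖ ≤ L) (v : Fin n → ℝ) :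
    ∑ i ∈ Finset.range r, h ^ 2 * Real.exp (2 * α * h) *
        (η⁻¹ * ‖K i *ᵥ ((C * A) *ᵥ v)‖₂ ^ 2) ≤
      η * (r * (4 ^ r * Real.exp (2 * α) * (L * ‖C * A‖) ^ 2) * ‖v‖₂ ^ 2) := by
  have hh2 : h ^ 2 ≤ 4 ^ r * (η ^ (r - 1)) ^ 2 * η ^ 2 := by
    calc h ^ 2 ≤ ((2 * η) ^ r) ^ 2 := by gcongr
      _ = 4 ^ r * (η ^ (r - 1)) ^ 2 * η ^ 2 := by
        rw [mul_pow, ← pow_sub_one_mul hr η, mul_pow, mul_pow, pow_right_comm]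
        norm_num
        ring
  have hexp : Real.exp (2 * α * h) ≤ Real.exp (2 * α) :=
    Real.exp_le_exp.2 (mul_le_of_le_one_right (by positivity) hh1)
  have hterm : ∀ i ∈ Finset.range r, h ^ 2 * Real.exp (2 * α * h) *
      (η⁻¹ * ‖K i *ᵥ ((C * A) *ᵥ v)‖₂ ^ 2) ≤
      η * (4 ^ r * Real.exp (2 * α) * (L * ‖C * A‖) ^ 2) * ‖v‖₂ ^ 2 := fun i hi => by
    have hi := pow_sq_mul_norm_mulVec_sq_le hη.le (hK i (Finset.mem_range.1 hi)) ((C * A) *ᵥ v)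
    calc _ ≤ 4 ^ r * (η ^ (r - 1)) ^ 2 * η ^ 2 * Real.exp (2 * α) *
          (η⁻¹ * ‖K i *ᵥ ((C * A) *ᵥ v)‖₂ ^ 2) := by gcongr
      _ = 4 ^ r * η * Real.exp (2 * α) *
          ((η ^ (r - 1)) ^ 2 * ‖K i *ᵥ ((C * A) *ᵥ v)‖₂ ^ 2) := by field_simp
      _ ≤ 4 ^ r * η * Real.exp (2 * α) * (L ^ 2 * (‖C * A‖ * ‖v‖₂) ^ 2) := by
        have hCA := norm_toLp_mulVec_le (C * A) v
        exact mul_le_mul_of_nonneg_left (hi.trans (by gcongr _ * ?_ ^ 2)) (by positivity)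
      _ = _ := by ring
  refine (Finset.sum_le_sum hterm).trans_eq ?_
  rw [Finset.sum_const, Finset.card_range, nsmul_eq_mul]
  ring

theorem sum_delay_le (hr : r ≠ 0) (hη : 0 ≤ η) (hK : ∀ i < r, η ^ (r - 1) * ‖K i‖ ≤ L)
    (z : Fin l → ℝ) :
    ∑ i ∈ Finset.range (r - 1), ((i + 1 : ℕ) * η) ^ r *
        (η ^ (r - 1) * ‖K (i + 1) *ᵥ z‖₂ ^ 2) ≤ η * (r * (r ^ r * L ^ 2) * ‖z‖₂ ^ 2) := by
  have hterm : ∀ i ∈ Finset.range (r - 1), ((i + 1 : ℕ) * η) ^ r *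
      (η ^ (r - 1) * ‖K (i + 1) *ᵥ z‖₂ ^ 2) ≤ η * (r ^ r * L ^ 2) * ‖z‖₂ ^ 2 := fun i hi => by
    have hir : i + 1 < r := by grind
    calc _ = η * ((i + 1 : ℕ) ^ r * ((η ^ (r - 1)) ^ 2 * ‖K (i + 1) *ᵥ z‖₂ ^ 2)) := by
          rw [mul_pow, ← pow_sub_one_mul hr η]
          ring
      _ ≤ η * (r ^ r * (L ^ 2 * ‖z‖₂ ^ 2)) := by
          gcongr η * (?_ ^ r * ?_)
          · exact_mod_cast hir.le
          · exact pow_sq_mul_norm_mulVec_sq_le hη (hK _ hir) z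
      _ = _ := by ring
  refine (Finset.sum_le_sum hterm).trans ?_
  rw [Finset.sum_const, Finset.card_range, nsmul_eq_mul]
  calc _ ≤ (r : ℝ) * (η * (r ^ r * L ^ 2) * ‖z‖₂ ^ 2) := by gcongr; omega
    _ = _ := by ring

theorem exp_delay_lower_bound (hα : 0 ≤ α) (hη1 : η ≤ 1) {i : ℕ} (hi : i ≤ r) :
    Real.exp (-2 * α * r) ≤ Real.exp (-2 * α * (i * η)) := by
  have hir : (i : ℝ) * η ≤ r :=
    (mul_le_of_le_one_right (Nat.cast_nonneg i) hη1).trans (by exact_mod_cast hi)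
  exact Real.exp_le_exp.2 (by nlinarith)

theorem le_sum_sampling_error (hr : r ≠ 0) (hα : 0 ≤ α) (hη : 0 < η) (hη1 : η ≤ 1)
    (d : ℕ → Fin m → ℝ) :
    Real.exp (-2 * α * r) / r ^ r / η * ∑ i ∈ Finset.range r, ‖d i‖₂ ^ 2 ≤
      ∑ i ∈ Finset.range r, Real.pi ^ 2 / 4 * Real.exp (-2 * α * (i * η)) *
          (η⁻¹ * ‖d i‖₂ ^ 2) := by
  rw [Finset.mul_sum]
  refine Finset.sum_le_sum fun i hi => ?_
  have hexp := exp_delay_lower_bound hα hη1 (Finset.mem_range.1 hi).le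
  have hpi : 1 ≤ Real.pi ^ 2 / 4 := by nlinarith [Real.two_le_pi]
  have hrr : (1 : ℝ) ≤ (r : ℝ) ^ r :=
    one_le_pow₀ (by exact_mod_cast Nat.one_le_iff_ne_zero.2 hr)
  rw [div_eq_mul_inv _ η, mul_assoc]
  gcongr ?_ * _
  calc _ ≤ Real.exp (-2 * α * r) := div_le_self (Real.exp_nonneg _) hrr
    _ ≤ Real.exp (-2 * α * (i * η)) := hexp
    _ ≤ _ := le_mul_of_one_le_left (Real.exp_nonneg _) hpi

theorem le_sum_delay_error (hr : r ≠ 0) (hα : 0 ≤ α) (hη : 0 < η) (hη1 : η ≤ 1)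
    (e : ℕ → Fin m → ℝ) :
    Real.exp (-2 * α * r) / r ^ r / η * ∑ i ∈ Finset.range (r - 1), ‖e (i + 1)‖₂ ^ 2 ≤
      ∑ i ∈ Finset.range (r - 1), (r ! : ℝ) ^ 2 / ((i + 1 : ℕ) * η) ^ r *
          Real.exp (-2 * α * ((i + 1 : ℕ) * η)) * (η ^ (r - 1) * ‖e (i + 1)‖₂ ^ 2) := by
  rw [Finset.mul_sum]
  refine Finset.sum_le_sum fun i hi => ?_
  have hir : i + 1 ≤ r := by grind
  have hexp := exp_delay_lower_bound hα hη1 hir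
  have hfact : (1 : ℝ) ≤ (r ! : ℝ) ^ 2 :=
    one_le_pow₀ (by exact_mod_cast Nat.one_le_iff_ne_zero.2 (Nat.factorial_ne_zero _))
  have : (0 : ℝ) < (i + 1 : ℕ) := by positivity
  calc _ = 1 / (r : ℝ) ^ r * Real.exp (-2 * α * r) * (η⁻¹ * ‖e (i + 1)‖₂ ^ 2) := by ring
    _ ≤ (r ! : ℝ) ^ 2 / (i + 1 : ℕ) ^ r * Real.exp (-2 * α * ((i + 1 : ℕ) * η)) *
        (η⁻¹ * ‖e (i + 1)‖₂ ^ 2) := by gcongr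
    _ = _ := by
      rw [mul_pow, ← pow_sub_one_mul hr η]
      field_simp

theorem small_delay_arith {V E c₀ c₁ c₂ c₃ : ℝ} (hV : 0 ≤ V) (hE : 0 ≤ E) (hc₃ : 0 ≤ c₃)
    (hη : 0 < η) (hη1 : η ≤ 1) (h₂ : η * c₂ ≤ 1 / 4) (h₀ : η * (c₁ + c₃) ≤ c₀) :
    -(1 / 4) * V + c₁ * E + η * (c₂ * V + c₃ * E) ≤ c₀ / η * E := by
  have hV₂ : η * c₂ * V ≤ 1 / 4 * V := by gcongr
  have hE₃ : η * c₃ * E ≤ c₃ * E := by gcongr; exact mul_le_of_le_one_left hc₃ hη1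
  have hE₀ : (c₁ + c₃) * E ≤ c₀ / η * E := by gcongr; rw [le_div_iff₀ hη]; linarith
  linarith

theorem norm_mulVec_add_mulVec_sq_le (M : Matrix (Fin l) (Fin n) ℝ) (v : Fin n → ℝ)
    (w : Fin m → ℝ) :
    ‖M *ᵥ (D *ᵥ v + B *ᵥ w)‖₂ ^ 2 ≤
      2 * (‖M * D‖ ^ 2 * ‖v‖₂ ^ 2 + ‖M * B‖ ^ 2 * ‖w‖₂ ^ 2) := by
  rw [Matrix.mulVec_add, Matrix.mulVec_mulVec, Matrix.mulVec_mulVec, ← mul_pow, ← mul_pow]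
  refine (norm_add_sq_le _ _).trans ?_
  gcongr <;> exact norm_toLp_mulVec_le _ _

-- The weights `η⁻¹` and `η ^ (r - 1)` balance the two sides: the gains are of order `η ^ (1 - r)`,
-- so with `h` of order `η ^ r` the gain terms are `O(η)`, against error terms of order `η⁻¹`.
theorem eventually_dissipation (hr : r ≠ 0) (hα : 0 ≤ α)
    (hP : ∀ v, 2 * (v ⬝ᵥ P *ᵥ (D *ᵥ v)) + 2 * α * (v ⬝ᵥ P *ᵥ v) ≤ -(1 / 2) * ‖v‖₂ ^ 2)
    (L : ℝ) :
    ∀ᶠ η in 𝓝[>] (0 : ℝ), ∀ (h : ℝ) (q : ℕ → ℕ) (K : ℕ → Matrix (Fin m) (Fin l) ℝ),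
      0 ≤ h → h ≤ 1 → h ≤ (2 * η) ^ r → (∀ i, (q i : ℝ) * h = i * η) →
      matD A B C r h q K = D → (∀ i < r, η ^ (r - 1) * ‖K i‖ ≤ L) →
      Dissipation A B C r h q K α P (fun _ => η⁻¹ • 1) (fun _ => η ^ (r - 1) • 1) := by
  set M := C * A ^ (r - 1)
  set a := (r : ℝ) * (4 ^ r * Real.exp (2 * α) * (L * ‖C * A‖) ^ 2)
  set b := (r : ℝ) * (r ^ r * L ^ 2)
  set c₀ := Real.exp (-2 * α * r) / (r : ℝ) ^ r
  set c₁ := 4 * ‖P * B‖ ^ 2 * (2 * r)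
  set c₂ := a + b * (2 * ‖M * D‖ ^ 2)
  set c₃ := b * (2 * (‖M * B‖ ^ 2 * (2 * r)))
  filter_upwards [self_mem_nhdsWithin, eventually_mul_le 1 one_pos,
    eventually_mul_le c₂ (b := 1 / 4) (by norm_num),
    eventually_mul_le (c₁ + c₃) (b := c₀) (by positivity)] with η hη hη1 h₂ h₀
  intro h q K hh hh1 hhη hqh hD hK v y d e hy
  rw [mul_one] at hη1
  set w := ∑ i ∈ Finset.range r, d i + ∑ i ∈ Finset.range (r - 1), e (i + 1)
  have hyw : y = D *ᵥ v + B *ᵥ w := by rw [hy, hD, Matrix.mulVec_add]; abel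
  set E := ∑ i ∈ Finset.range r, ‖d i‖₂ ^ 2 + ∑ i ∈ Finset.range (r - 1), ‖e (i + 1)‖₂ ^ 2
  have hw : ‖w‖₂ ^ 2 ≤ 2 * r * E := norm_sum_add_sum_sq_le d e
  have hstate : 2 * (v ⬝ᵥ P *ᵥ y) + 2 * α * (v ⬝ᵥ P *ᵥ v) ≤ -(1 / 4) * ‖v‖₂ ^ 2 + c₁ * E := by
    calc _ ≤ -(1 / 4) * ‖v‖₂ ^ 2 + 4 * ‖P * B‖ ^ 2 * ‖w‖₂ ^ 2 :=
          hyw ▸ lyapunov_perturbed_le hP v w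
      _ ≤ -(1 / 4) * ‖v‖₂ ^ 2 + 4 * ‖P * B‖ ^ 2 * (2 * r * E) := by gcongr
      _ = _ := by ring
  have hMy : b * ‖M *ᵥ y‖₂ ^ 2 ≤ b * (2 * ‖M * D‖ ^ 2) * ‖v‖₂ ^ 2 + c₃ * E := by
    calc _ ≤ b * (2 * (‖M * D‖ ^ 2 * ‖v‖₂ ^ 2 + ‖M * B‖ ^ 2 * ‖w‖₂ ^ 2)) := by
          gcongr
          exact hyw ▸ norm_mulVec_add_mulVec_sq_le M v w
      _ ≤ b * (2 * (‖M * D‖ ^ 2 * ‖v‖₂ ^ 2 + ‖M * B‖ ^ 2 * (2 * r * E))) := by gcongr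
      _ = _ := by ring
  have hsampling := sum_sampling_le (A := A) (C := C) hr hα hh hh1 hη hhη hK v
  have hdelay := (sum_delay_le hr hη.le hK (M *ᵥ y)).trans (mul_le_mul_of_nonneg_left hMy hη.le)
  have hbalance := small_delay_arith (sq_nonneg ‖v‖₂) (E := E) (by positivity)
    (c₃ := c₃) (by positivity) hη hη1 h₂ h₀
  have hd := le_sum_sampling_error hr hα hη hη1 d
  have he := le_sum_delay_error hr hα hη hη1 e
  simp only [dotProduct_smul_one_mulVec, hqh]
  linear_combination hstate + hsampling + hdelay + hbalance + hd + he

end SmallDelay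

section SamplingThreshold

theorem smallest_delay_bounds {r : ℕ} (hr : r ≠ 0) {h : ℝ} (hh : 0 < h) (hh1 : h ≤ 1) :
    0 < ⌊h ^ ((1 : ℝ) / (r : ℝ) - 1)⌋₊ ∧
    (⌊h ^ ((1 : ℝ) / (r : ℝ) - 1)⌋₊ : ℝ) * h ≤ h ^ ((1 : ℝ) / (r : ℝ)) ∧
    h ≤ (2 * ((⌊h ^ ((1 : ℝ) / (r : ℝ) - 1)⌋₊ : ℝ) * h)) ^ r := by
  have hr1 : (1 : ℝ) / r ≤ 1 := by
    rw [one_div]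
    exact Nat.cast_inv_le_one r
  set s := h ^ ((1 : ℝ) / (r : ℝ) - 1)
  have hs1 : 1 ≤ s := Real.one_le_rpow_of_pos_of_le_one_of_nonpos hh hh1 (by linarith)
  have hsh : s * h = h ^ ((1 : ℝ) / (r : ℝ)) := by
    rw [← Real.rpow_add_one hh.ne', sub_add_cancel]
  have hfloor : 1 ≤ ⌊s⌋₊ := Nat.le_floor (by exact_mod_cast hs1)
  refine ⟨hfloor, ?_, ?_⟩
  · rw [← hsh]
    gcongr
    exact Nat.floor_le (by positivity)
  · have hs2 : s ≤ 2 * ⌊s⌋₊ := by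
      have : (1 : ℝ) ≤ ⌊s⌋₊ := by exact_mod_cast hfloor
      linarith [Nat.lt_floor_add_one s]
    calc h = (s * h) ^ r := by rw [hsh, one_div, Real.rpow_inv_natCast_pow hh.le hr]
      _ ≤ (2 * (⌊s⌋₊ * h)) ^ r := by
          rw [← mul_assoc]
          gcongr

open scoped Matrix.Norms.L2Operator

variable {n m l : ℕ} {A : Matrix (Fin n) (Fin n) ℝ} {B : Matrix (Fin n) (Fin m) ℝ}
  {C : Matrix (Fin l) (Fin n) ℝ} {r : ℕ} {Kbar : ℕ → Matrix (Fin m) (Fin l) ℝ} {α α' : ℝ}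

theorem IsExpStable.exists_lyapunov_derivativeLoop (hCB : ∀ i, i + 2 ≤ r → C * A ^ i * B = 0)
    (hstab : IsExpStable (IsDerivativeLoop A B C r Kbar) α') (hαα' : α < α') :
    ∃ P : Matrix (Fin n) (Fin n) ℝ, P.PosDef ∧ ∀ v,
      2 * (v ⬝ᵥ P *ᵥ ((A + B * (gainRow r Kbar * outputCol A C r)) *ᵥ v)) +
        2 * α * (v ⬝ᵥ P *ᵥ v) ≤ -(1 / 2) * ‖WithLp.toLp 2 v‖ ^ 2 := by
  obtain ⟨-, c, hc⟩ := hstab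
  refine exists_lyapunov (c := c) hαα' fun v t ht => ?_
  simpa only [flow_zero, one_apply_eq_self] using
    hc _ (isDerivativeLoop_flow hCB Kbar v) t ht

theorem exists_sampling_threshold (hr : 2 ≤ r) (hCB : ∀ i, i + 2 ≤ r → C * A ^ i * B = 0)
    (hα : 0 ≤ α) (hαα' : α < α') (hstab : IsExpStable (IsDerivativeLoop A B C r Kbar) α') :
    ∃ h₀ : ℝ, 0 < h₀ ∧ ∀ h : ℝ, 0 < h → h < h₀ →
      ∀ q : ℕ → ℕ, (∀ i : ℕ, q i = i * ⌊h ^ ((1 : ℝ) / (r : ℝ) - 1)⌋₊) →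
        (∀ i : ℕ, i + 1 < r → q i < q (i + 1)) ∧
        IsUnit (vandermondeM l r h q).det ∧
        ∀ K : ℕ → Matrix (Fin m) (Fin l) ℝ,
          gainRow r K = gainRow r Kbar * (vandermondeM l r h q)⁻¹ →
          IsExpStable (IsSampledLoop A B C r h q K) α := by
  obtain ⟨P, hP, hlyap⟩ := hstab.exists_lyapunov_derivativeLoop hCB hαα'
  set L := ∑ i : Fin r, ∑ j : Fin r, |(unitVandermonde r)⁻¹ j i| * ‖Kbar j‖
  have hr0 : r ≠ 0 := by omega
  obtain ⟨η₀, hη₀, hsmall⟩ := mem_nhdsGT_iff_exists_Ioc_subset.1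
    (eventually_dissipation (A := A) (C := C) hr0 hα hlyap L)
  refine ⟨min 1 (η₀ ^ r), lt_min one_pos (pow_pos hη₀ r), fun h hh hhlt q hq => ?_⟩
  have hh1 : h ≤ 1 := hhlt.le.trans (min_le_left _ _)
  obtain ⟨hp, hηle, hhη⟩ := smallest_delay_bounds hr0 hh hh1
  set p := ⌊h ^ ((1 : ℝ) / (r : ℝ) - 1)⌋₊
  set η := (p : ℝ) * h
  have hη0 : 0 < η := by positivity
  have hη1 : η ≤ 1 := hηle.trans (Real.rpow_le_one hh.le hh1 (by positivity))
  have hηη₀ : η ≤ η₀ := by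
    calc η ≤ h ^ ((1 : ℝ) / (r : ℝ)) := hηle
      _ ≤ (η₀ ^ r) ^ ((1 : ℝ) / (r : ℝ)) := by
          gcongr
          exact hhlt.le.trans (min_le_right _ _)
      _ = η₀ := by rw [one_div, Real.pow_rpow_inv_natCast (le_of_lt hη₀) hr0]
  have hqlt : ∀ i : ℕ, i + 1 < r → q i < q (i + 1) := fun i _ => by
    rw [hq, hq, add_mul, one_mul]
    omega
  have hM := isUnit_det_vandermondeM (r := r) l hq hη0.ne'
  refine ⟨hqlt, hM, fun K hK => ?_⟩
  have hD : matD A B C r h q K = A + B * (gainRow r Kbar * outputCol A C r) := by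
    rw [matD, hK, Matrix.nonsing_inv_mul_cancel_right _ _ hM]
  have hqη : ∀ i : ℕ, (q i : ℝ) * h = i * η := fun i => by
    rw [hq, Nat.cast_mul, mul_assoc]
  have hdis := hsmall ⟨hη0, hηη₀⟩ h q K hh.le hh1 hhη hqη hD
    (pow_mul_norm_gain_le hq hη0 hη1 hK)
  exact hdis.isExpStable hr hCB hh (by rw [hq, zero_mul]) hqlt hα hP
    (fun _ _ => (Matrix.PosDef.one.smul (inv_pos.2 hη0)).posSemidef)
    (fun _ _ _ => (Matrix.PosDef.one.smul (pow_pos hη0 _)).posSemidef)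

end SamplingThreshold

end SampledData

end

theorem theorem1 {n m l : ℕ} (r : ℕ) (hr : 2 ≤ r)
    (A : Matrix (Fin n) (Fin n) ℝ) (B : Matrix (Fin n) (Fin m) ℝ) (C : Matrix (Fin l) (Fin n) ℝ)
    (hrel : SampledData.HasRelativeDegree A B C r) :
    -- Part (i): feasibility of the LMI gives exponential stability with decay rate `α`.
    (∀ (h : ℝ) (q : ℕ → ℕ) (K : ℕ → Matrix (Fin m) (Fin l) ℝ) (α : ℝ),
      0 < h → q 0 = 0 → (∀ i : ℕ, i + 1 < r → q i < q (i + 1)) → 0 < α →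
      (∃ (P : Matrix (Fin n) (Fin n) ℝ) (W R : ℕ → Matrix (Fin m) (Fin m) ℝ),
        P.PosDef ∧ (∀ i : ℕ, i < r → (W i).PosDef) ∧
        (∀ i : ℕ, 1 ≤ i → i < r → (R i).PosDef) ∧
        (-SampledData.Phi A B C r h q K α P W R).PosSemidef) →
      SampledData.IsExpStable (SampledData.IsSampledLoop A B C r h q K) α) ∧
    -- Part (ii): any decay rate `α < α'` is preserved for all small enough `h`.
    (∀ (Kbar : ℕ → Matrix (Fin m) (Fin l) ℝ) (α' : ℝ), 0 < α' →
      SampledData.IsExpStable (SampledData.IsDerivativeLoop A B C r Kbar) α' →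
      ∀ α : ℝ, α < α' → ∃ h₀ : ℝ, 0 < h₀ ∧ ∀ h : ℝ, 0 < h → h < h₀ →
        ∀ q : ℕ → ℕ, (∀ i : ℕ, q i = i * ⌊h ^ ((1 : ℝ) / (r : ℝ) - 1)⌋₊) →
          (∀ i : ℕ, i + 1 < r → q i < q (i + 1)) ∧
          IsUnit (SampledData.vandermondeM l r h q).det ∧
          ∀ K : ℕ → Matrix (Fin m) (Fin l) ℝ,
            SampledData.gainRow r K =
              SampledData.gainRow r Kbar * (SampledData.vandermondeM l r h q)⁻¹ →
            SampledData.IsExpStable (SampledData.IsSampledLoop A B C r h q K) α) := by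
  obtain ⟨hCB, _⟩ := hrel
  refine ⟨fun h q K α hh hq0 hq hα => ?_, fun Kbar α' hα' hstab α hα => ?_⟩
  · rintro ⟨P, W, R, hP, hW, hR, hPhi⟩
    exact SampledData.isExpStable_of_Phi hr hCB hh hq0 hq hα.le hP
      (fun i hi => (hW i hi).posSemidef) (fun i h1 hi => (hR i h1 hi).posSemidef) hPhi
  · obtain ⟨h₀, hh₀, hsmall⟩ := SampledData.exists_sampling_threshold hr hCB (le_max_right α 0)
      (max_lt hα hα') hstab
    refine ⟨h₀, hh₀, fun h hh hlt q hq => ?_⟩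
    obtain ⟨hmono, hM, hK⟩ := hsmall h hh hlt q hq
    exact ⟨hmono, hM, fun K hgain => (hK K hgain).mono (le_max_left α 0)⟩
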